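/- (Cyclotomic norms.) All rings are commutative with unit. For a ring $R$ and an integer $m\ge 1$, let $\mathbb{W}_m(R)$ be the ring of $m$-truncated big Witt vectors: its underlying set is $\prod_{e\mid m}R$, and its ring structure is the one, functorial in $R$, for which all ghost coordinates $\mathrm{gh}_e(x)=\sum_{d\mid e}d\,x_d^{e/d}$ ($e\mid m$) are ring homomorphisms. For $m\mid m'$ and $d=m'/m$, let $F_d:\mathbb{W}_{m'}(R)\to\mathbb{W}_m(R)$ be the Frobenius (natural in $R$, with $\mathrm{gh}_e(F_d x)=\mathrm{gh}_{de}(x)$) and let $V_d:\mathbb{W}_m(R)\to\mathbb{W}_{m'}(R)$ be the Verschiebung, with $(V_dx)_e=x_{e/d}$ if $d\mid e$ and $(V_dx)_e=0$ otherwise. The $m$-truncated big $q$-Witt vectors of $R$ are $q\text{-}\mathbb{W}_m(R):=\mathbb{W}_m(R)[q]/\mathbb{I}_m$, where $\mathbb{I}_m$ is the ideal generated by the elements $(q^e-1)V_{m/e}(x)$ for $e\mid m$, $x\in\mathbb{W}_e(R)$, and $[e/d]_{q^d}V_{m/e}(x)-V_{m/d}(F_{e/d}(x))$ for $d\mid e\mid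 m$, $x\in\mathbb{W}_e(R)$; here $[k]_{q^d}=1+q^d+\dots+q^{d(k-1)}$. The $q$-ghost map $$q\text{-}\mathrm{gh}: q\text{-}\mathbb{W}_m(R)\longrightarrow\prod_{e\mid m}R[q]/\Phi_e(q)$$ is the $\mathbb{Z}[q]$-algebra map that sends $x\in\mathbb{W}_m(R)$ to $(\mathrm{gh}_{m/e}(x))_{e\mid m}$, where $\Phi_e$ is the $e$-th cyclotomic polynomial. Write $(a,b)$ and $[a,b]$ for the greatest common divisor and the least common multiple of $a$ and $b$. Let $m,m'\ge 1$ be integers with $m\mid m'$. Then there are morphisms of multiplicative monoids $$\Pi_{m'/m}:q\text{-}\mathbb{W}_m(R)\longrightarrow q\text{-}\mathbb{W}_{m'}(R),$$ one for every commutative ring $R$, which are natural in $R$ and are given in $q$-ghost coordinates by $$(c_e(q))_{e\mid m}\longmapsto\Big(c_{(e,m)}\big(q^{e/(e,m)}\big)^{m'/[e,m]}\Big)_{e\mid m'} ,$$ that is, if $c\in q\text{-}\mathbb{W}_m(R)$ has $q$-ghost coordinates $(c_e(q))_{e\mid m}$, then $\Pi_{m'/m}(c)$ has the $q$-ghost coordinates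 on the right-hand side. Moreover, $\Pi_{m'/m}$ is uniquely determined by these two properties: every family of maps $q\text{-}\mathbb{W}_m(R)\to q\text{-}\mathbb{W}_{m'}(R)$ that is natural in $R$ and satisfies this formula on $q$-ghost coordinates for every $R$ coincides with $\Pi_{m'/m}$. -/

import Mathlib

open Polynomial

universe u

namespace BigWitt

section Dwork

variable {A : Type*} [CommRing A]

/-- The ghost expression `∑_{d ∣ e} d * x_d ^ (e / d)`. -/
def ghostSum (x : ℕ → A) (e : ℕ) : A :=
  ∑ d ∈ e.divisors, (d : A) * x d ^ (e / d)

/-- Recursive solution `x` of the system `ghostSum x e = y e` for all `e ≥ 1`, whenever the system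
is solvable step by step (a junk value is chosen otherwise); see `ghostSum_solve`. -/
noncomputable def solve (y : ℕ → A) (e : ℕ) : A :=
  Classical.epsilon fun z : A =>
    (e : A) * z = y e - ∑ d ∈ e.properDivisors.attach, (d.1 : A) * solve y d.1 ^ (e / d.1)
termination_by e
decreasing_by exact (Nat.mem_properDivisors.mp d.2).2

theorem ghostSum_congr {x x' : ℕ → A} {e : ℕ} (h : ∀ d, d ∣ e → x d = x' d) :
    ghostSum x e = ghostSum x' e :=
  Finset.sum_congr rfl fun d hd => by rw [h d (Nat.dvd_of_mem_divisors hd)]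

theorem ghostSum_eq_add (x : ℕ → A) {e : ℕ} (he : e ≠ 0) :
    ghostSum x e = (e : A) * x e + ∑ d ∈ e.properDivisors, (d : A) * x d ^ (e / d) := by
  rw [ghostSum, ← Nat.insert_self_properDivisors he,
    Finset.sum_insert Nat.self_notMem_properDivisors, Nat.div_self (Nat.pos_of_ne_zero he), pow_one]

theorem natCast_dvd_of_prime_pow {n : ℕ} (hn : n ≠ 0) {a : A}
    (h : ∀ p : ℕ, p.Prime → p ∣ n → (p : A) ^ n.factorization p ∣ a) : (n : A) ∣ a := by
  have hprod : (n : A) = ∏ p ∈ n.primeFactors, ((p ^ n.factorization p : ℕ) : A) := by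
    rw [← Nat.cast_prod]
    congr 1
    exact (Nat.prod_factorization_pow_eq_self hn).symm
  rw [hprod]
  apply Finset.prod_dvd_of_coprime
  · intro p hp q hq hpq
    apply Nat.Coprime.cast
    exact Nat.Coprime.pow _ _ ((Nat.coprime_primes (Nat.prime_of_mem_primeFactors hp)
      (Nat.prime_of_mem_primeFactors hq)).mpr hpq)
  · intro p hp
    rw [Nat.cast_pow]
    exact h p (Nat.prime_of_mem_primeFactors hp) (Nat.dvd_of_mem_primeFactors hp)

theorem pow_dvd_pow_sub_pow {p : ℕ} {a b : A} (h : (p : A) ∣ a - b) (k : ℕ) :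
    (p : A) ^ (k.factorization p + 1) ∣ a ^ k - b ^ k := by
  obtain ⟨u, hu⟩ := Nat.ordProj_dvd k p
  have h1 := dvd_sub_pow_of_dvd_sub h (k.factorization p)
  refine h1.trans ?_
  conv_rhs => rw [hu, pow_mul, pow_mul]
  exact sub_dvd_pow_sub_pow _ _ u

theorem ghostSum_dwork {φ : ℕ → A →+* A}
    (hφ : ∀ p : ℕ, p.Prime → ∀ a, (p : A) ∣ a ^ p - φ p a) (x : ℕ → A) {p e : ℕ}
    (hp : p.Prime) (he : e ≠ 0) (hpe : p ∣ e) :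
    (p : A) ^ e.factorization p ∣ ghostSum x e - φ p (ghostSum x (e / p)) := by
  obtain ⟨f, rfl⟩ := hpe
  have hf : f ≠ 0 := by rintro rfl; simp at he
  rw [Nat.mul_div_cancel_left _ hp.pos]
  have hsub : f.divisors ⊆ (p * f).divisors :=
    Nat.divisors_subset_of_dvd he (Dvd.intro_left p rfl)
  have hfac : (p * f).factorization p = f.factorization p + 1 := by
    rw [Nat.factorization_mul hp.ne_zero hf, Finsupp.add_apply, hp.factorization_self, add_comm]
  have key : ghostSum x (p * f) - φ p (ghostSum x f) =
      ∑ d ∈ (p * f).divisors \ f.divisors, (d : A) * x d ^ (p * f / d) +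
      ∑ d ∈ f.divisors, (d : A) * ((x d ^ p) ^ (f / d) - φ p (x d) ^ (f / d)) := by
    simp only [ghostSum, map_sum, map_mul, map_pow, map_natCast, mul_sub, Finset.sum_sub_distrib]
    rw [← Finset.sum_sdiff hsub, add_sub_assoc]
    congr 2
    refine Finset.sum_congr rfl fun d hd => ?_
    rw [← pow_mul, Nat.mul_div_assoc _ (Nat.dvd_of_mem_divisors hd)]
  rw [key]
  refine dvd_add (Finset.dvd_sum fun d hd => ?_) (Finset.dvd_sum fun d hd => ?_)
  · rw [Finset.mem_sdiff, Nat.mem_divisors, Nat.mem_divisors] at hd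
    obtain ⟨⟨hd1, -⟩, hd2⟩ := hd
    refine Dvd.dvd.mul_right ?_ _
    rw [← Nat.cast_pow]
    apply Nat.cast_dvd_cast
    have hd0 : d ≠ 0 := by rintro rfl; exact he (Nat.eq_zero_of_zero_dvd hd1)
    rw [hp.pow_dvd_iff_le_factorization hd0, hfac]
    by_contra hlt
    apply hd2
    refine ⟨?_, hf⟩
    rw [← Nat.factorization_le_iff_dvd hd0 hf]
    intro r
    have h1 := (Nat.factorization_le_iff_dvd hd0 he).mpr hd1 r
    rw [Nat.factorization_mul hp.ne_zero hf, Finsupp.add_apply, hp.factorization] at h1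
    by_cases hr : r = p
    · subst hr; omega
    · simpa [Finsupp.single_apply, Ne.symm hr] using h1
  · have hdf := Nat.dvd_of_mem_divisors hd
    obtain ⟨k, rfl⟩ := hdf
    have hd0 : d ≠ 0 := left_ne_zero_of_mul hf
    have hk0 : k ≠ 0 := right_ne_zero_of_mul hf
    rw [hfac, Nat.mul_div_cancel_left _ (Nat.pos_of_ne_zero hd0), Nat.factorization_mul hd0 hk0,
      Finsupp.add_apply, add_assoc, pow_add]
    refine mul_dvd_mul ?_ (pow_dvd_pow_sub_pow (hφ p hp _) k)
    rw [← Nat.cast_pow]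
    exact Nat.cast_dvd_cast (Nat.ordProj_dvd d p)

/-- Dwork's lemma (existence of a solution in the presence of Frobenius lifts). -/
theorem ghostSum_solve {φ : ℕ → A →+* A}
    (hφ : ∀ p : ℕ, p.Prime → ∀ a, (p : A) ∣ a ^ p - φ p a) {y : ℕ → A}
    (hy : ∀ p e : ℕ, p.Prime → e ≠ 0 → p ∣ e →
      (p : A) ^ e.factorization p ∣ y e - φ p (y (e / p))) {e : ℕ} (he : e ≠ 0) :
    ghostSum (solve y) e = y e := by
  induction e using Nat.strong_induction_on with
  | _ e ih =>
  have hex : ∃ z : A, (e : A) * z =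
      y e - ∑ d ∈ e.properDivisors.attach, (d.1 : A) * solve y d.1 ^ (e / d.1) := by
    rw [Finset.sum_attach e.properDivisors fun d => (d : A) * solve y d ^ (e / d)]
    suffices h : (e : A) ∣ y e - ∑ d ∈ e.properDivisors, (d : A) * solve y d ^ (e / d) by
      obtain ⟨z, hz⟩ := h
      exact ⟨z, hz.symm⟩
    refine natCast_dvd_of_prime_pow he fun p hp hpe => ?_
    have hlt : e / p < e := Nat.div_lt_self (Nat.pos_of_ne_zero he) hp.one_lt
    have hne : e / p ≠ 0 :=
      (Nat.div_pos (Nat.le_of_dvd (Nat.pos_of_ne_zero he) hpe) hp.pos).ne'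
    have h1 := ghostSum_dwork hφ (Function.update (solve y) e 0) hp he hpe
    have h2 : ghostSum (Function.update (solve y) e 0) (e / p) = y (e / p) := by
      rw [← ih _ hlt hne]
      refine ghostSum_congr fun d hd => ?_
      rw [Function.update_of_ne]
      exact ((Nat.le_of_dvd (Nat.pos_of_ne_zero hne) hd).trans_lt hlt).ne
    have h3 : ghostSum (Function.update (solve y) e 0) e =
        ∑ d ∈ e.properDivisors, (d : A) * solve y d ^ (e / d) := by
      rw [ghostSum_eq_add _ he, Function.update_self, mul_zero, zero_add]
      refine Finset.sum_congr rfl fun d hd => ?_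
      rw [Function.update_of_ne (Nat.mem_properDivisors.mp hd).2.ne]
    rw [h2, h3] at h1
    have h4 := dvd_sub (hy p e hp he hpe) h1
    rwa [sub_sub_sub_cancel_right] at h4
  have h := Classical.epsilon_spec hex
  rw [ghostSum_eq_add _ he]
  conv_lhs => enter [1, 2]; rw [solve]
  rw [h, Finset.sum_attach e.properDivisors fun d => (d : A) * solve y d ^ (e / d),
    sub_add_cancel]

theorem map_ghostSum {B : Type*} [CommRing B] (f : A →+* B) (x : ℕ → A) (e : ℕ) :
    f (ghostSum x e) = ghostSum (fun d => f (x d)) e := by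
  simp [ghostSum]

theorem ghostSum_injective [IsDomain A] [CharZero A] {x x' : ℕ → A} {m : ℕ}
    (h : ∀ e ∈ m.divisors, ghostSum x e = ghostSum x' e) : ∀ e ∈ m.divisors, x e = x' e := by
  intro e
  induction e using Nat.strong_induction_on with
  | _ e ih =>
  intro hem
  have he : e ≠ 0 := (Nat.pos_of_mem_divisors hem).ne'
  have h1 := h e hem
  rw [ghostSum_eq_add _ he, ghostSum_eq_add _ he] at h1
  have h2 : ∑ d ∈ e.properDivisors, (d : A) * x d ^ (e / d) =
      ∑ d ∈ e.properDivisors, (d : A) * x' d ^ (e / d) := by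
    refine Finset.sum_congr rfl fun d hd => ?_
    rw [Nat.mem_properDivisors] at hd
    rw [ih d hd.2 (Nat.mem_divisors.mpr
      ⟨hd.1.trans (Nat.dvd_of_mem_divisors hem), (Nat.mem_divisors.mp hem).2⟩)]
  rw [h2] at h1
  exact mul_left_cancel₀ (Nat.cast_ne_zero.mpr he) (add_right_cancel h1)

end Dwork

section Polynomials

variable {σ : Type*}

theorem expand_frobenius (p : ℕ) (hp : p.Prime) (a : MvPolynomial σ ℤ) :
    (p : MvPolynomial σ ℤ) ∣ a ^ p - (MvPolynomial.expand p : _ →ₐ[ℤ] _).toRingHom a := by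
  have := Fact.mk hp
  rw [← map_natCast (MvPolynomial.C : ℤ →+* MvPolynomial σ ℤ), MvPolynomial.C_dvd_iff_zmod]
  simp [MvPolynomial.map_expand, MvPolynomial.expand_zmod]

/-- Universal polynomials of the addition of big Witt vectors. -/
noncomputable def addPoly : ℕ → MvPolynomial (Bool × ℕ) ℤ :=
  solve fun e => ghostSum (fun d => MvPolynomial.X (false, d)) e +
    ghostSum (fun d => MvPolynomial.X (true, d)) e

/-- Universal polynomials of the multiplication of big Witt vectors. -/
noncomputable def mulPoly : ℕ → MvPolynomial (Bool × ℕ) ℤ :=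
  solve fun e => ghostSum (fun d => MvPolynomial.X (false, d)) e *
    ghostSum (fun d => MvPolynomial.X (true, d)) e

/-- Universal polynomials of the negation of big Witt vectors. -/
noncomputable def negPoly : ℕ → MvPolynomial ℕ ℤ :=
  solve fun e => -ghostSum MvPolynomial.X e

/-- Universal polynomials of the `d`-th Frobenius of big Witt vectors. -/
noncomputable def frobPoly (d : ℕ) : ℕ → MvPolynomial ℕ ℤ :=
  solve fun e => ghostSum MvPolynomial.X (d * e)

theorem ghostSum_addPoly {e : ℕ} (he : e ≠ 0) :
    ghostSum addPoly e = ghostSum (fun d => MvPolynomial.X (false, d)) e +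
      ghostSum (fun d => MvPolynomial.X (true, d)) e := by
  refine ghostSum_solve expand_frobenius (fun p e hp he hpe => ?_) he
  rw [map_add, add_sub_add_comm]
  exact dvd_add (ghostSum_dwork expand_frobenius _ hp he hpe)
    (ghostSum_dwork expand_frobenius _ hp he hpe)

theorem ghostSum_mulPoly {e : ℕ} (he : e ≠ 0) :
    ghostSum mulPoly e = ghostSum (fun d => MvPolynomial.X (false, d)) e *
      ghostSum (fun d => MvPolynomial.X (true, d)) e := by
  refine ghostSum_solve expand_frobenius (fun p e hp he hpe => ?_) he
  have h (a b a' b' : MvPolynomial (Bool × ℕ) ℤ) :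
      a * b - a' * b' = (a - a') * b + a' * (b - b') := by ring
  rw [map_mul, h]
  exact dvd_add ((ghostSum_dwork expand_frobenius _ hp he hpe).mul_right _)
    ((ghostSum_dwork expand_frobenius _ hp he hpe).mul_left _)

theorem ghostSum_negPoly {e : ℕ} (he : e ≠ 0) :
    ghostSum negPoly e = -ghostSum MvPolynomial.X e := by
  refine ghostSum_solve expand_frobenius (fun p e hp he hpe => ?_) he
  rw [map_neg, ← neg_sub']
  exact (ghostSum_dwork expand_frobenius _ hp he hpe).neg_right

theorem ghostSum_frobPoly {d : ℕ} (hd : d ≠ 0) {e : ℕ} (he : e ≠ 0) :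
    ghostSum (frobPoly d) e = ghostSum MvPolynomial.X (d * e) := by
  refine ghostSum_solve expand_frobenius (fun p e hp he hpe => ?_) he
  have h := ghostSum_dwork expand_frobenius (MvPolynomial.X : ℕ → MvPolynomial ℕ ℤ) hp
    (mul_ne_zero hd he) (hpe.mul_left d)
  rw [Nat.mul_div_assoc _ hpe] at h
  refine (pow_dvd_pow _ ?_).trans h
  rw [Nat.factorization_mul hd he, Finsupp.add_apply]
  exact Nat.le_add_left _ _

end Polynomials

end BigWitt

/-- The `m`-truncated big Witt vectors of `R`, `m ≥ 1`: families `(x_e)_{e ∣ m}` of elements of `R`,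
with the ring structure given by the universal integral polynomials that make the ghost map
`x ↦ (∑_{d ∣ e} d * x_d ^ (e / d))_{e ∣ m}` a ring homomorphism for every commutative ring `R`. -/
@[ext]
structure BigWitt (m : ℕ) (R : Type*) where
  /-- The Witt coordinates. -/
  toFun : m.divisors → R

namespace BigWitt

variable {m : ℕ} {R S : Type*} [CommRing R] [CommRing S]

/-- The Witt coordinates, extended by `0` to all natural numbers. -/
def coeff (x : BigWitt m R) (e : ℕ) : R :=
  if h : e ∈ m.divisors then x.toFun ⟨e, h⟩ else 0

/-- The big Witt vector with Witt coordinates `(f e)_{e ∣ m}`. -/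
def ofFun (m : ℕ) (f : ℕ → R) : BigWitt m R := ⟨fun e => f e⟩

theorem coeff_ofFun (f : ℕ → R) {e : ℕ} (he : e ∈ m.divisors) : (ofFun m f).coeff e = f e := by
  simp only [coeff, ofFun, dif_pos he]

theorem ext_coeff {x y : BigWitt m R} (h : ∀ e ∈ m.divisors, x.coeff e = y.coeff e) : x = y := by
  ext ⟨e, he⟩
  simpa only [coeff, dif_pos he] using h e he

/-- The `e`-th ghost coordinate, for `e ∣ m`. -/
def ghost (x : BigWitt m R) (e : ℕ) : R := ghostSum x.coeff e

theorem ghost_ofFun (f : ℕ → R) {e : ℕ} (he : e ∈ m.divisors) :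
    (ofFun m f).ghost e = ghostSum f e :=
  ghostSum_congr fun _ hd => coeff_ofFun f (Nat.mem_divisors.mpr
    ⟨hd.trans (Nat.dvd_of_mem_divisors he), (Nat.mem_divisors.mp he).2⟩)

theorem ext_ghost [IsDomain R] [CharZero R] {x y : BigWitt m R}
    (h : ∀ e ∈ m.divisors, x.ghost e = y.ghost e) : x = y :=
  ext_coeff (ghostSum_injective h)

/-- The variables of the two-variable structure polynomials, specialised to two Witt vectors. -/
def pair (x y : BigWitt m R) (i : Bool × ℕ) : R := bif i.1 then y.coeff i.2 else x.coeff i.2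

instance : Zero (BigWitt m R) := ⟨ofFun m fun _ => 0⟩

instance : One (BigWitt m R) := ⟨ofFun m fun e => if e = 1 then 1 else 0⟩

noncomputable instance : Add (BigWitt m R) :=
  ⟨fun x y => ofFun m fun e => MvPolynomial.aeval (pair x y) (addPoly e)⟩

noncomputable instance : Mul (BigWitt m R) :=
  ⟨fun x y => ofFun m fun e => MvPolynomial.aeval (pair x y) (mulPoly e)⟩

noncomputable instance : Neg (BigWitt m R) :=
  ⟨fun x => ofFun m fun e => MvPolynomial.aeval x.coeff (negPoly e)⟩

theorem ghostSum_aeval {σ : Type*} (v : σ → R) (P : ℕ → MvPolynomial σ ℤ) (e : ℕ) :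
    ghostSum (fun d => MvPolynomial.aeval v (P d)) e = MvPolynomial.aeval v (ghostSum P e) :=
  (map_ghostSum (MvPolynomial.aeval v : MvPolynomial σ ℤ →ₐ[ℤ] R).toRingHom P e).symm

theorem ne_zero_of_mem {e : ℕ} (he : e ∈ m.divisors) : e ≠ 0 := (Nat.pos_of_mem_divisors he).ne'

theorem ghost_zero {e : ℕ} (he : e ∈ m.divisors) : (0 : BigWitt m R).ghost e = 0 := by
  refine (ghost_ofFun _ he).trans (Finset.sum_eq_zero fun d hd => ?_)
  rw [zero_pow, mul_zero]
  exact (Nat.div_pos (Nat.divisor_le hd) (Nat.pos_of_mem_divisors hd)).ne'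

theorem ghost_one {e : ℕ} (he : e ∈ m.divisors) : (1 : BigWitt m R).ghost e = 1 := by
  refine (ghost_ofFun _ he).trans ?_
  rw [ghostSum, Finset.sum_eq_single 1]
  · simp
  · intro d hd h1
    rw [if_neg h1, zero_pow, mul_zero]
    exact (Nat.div_pos (Nat.divisor_le hd) (Nat.pos_of_mem_divisors hd)).ne'
  · intro h
    exact absurd (Nat.one_mem_divisors.mpr (ne_zero_of_mem he)) h

theorem ghost_add (x y : BigWitt m R) {e : ℕ} (he : e ∈ m.divisors) :
    (x + y).ghost e = x.ghost e + y.ghost e := by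
  refine (ghost_ofFun _ he).trans ?_
  rw [ghostSum_aeval, ghostSum_addPoly (ne_zero_of_mem he), map_add, ← ghostSum_aeval,
    ← ghostSum_aeval]
  simp [pair, ghost]

theorem ghost_mul (x y : BigWitt m R) {e : ℕ} (he : e ∈ m.divisors) :
    (x * y).ghost e = x.ghost e * y.ghost e := by
  refine (ghost_ofFun _ he).trans ?_
  rw [ghostSum_aeval, ghostSum_mulPoly (ne_zero_of_mem he), map_mul, ← ghostSum_aeval,
    ← ghostSum_aeval]
  simp [pair, ghost]

theorem ghost_neg (x : BigWitt m R) {e : ℕ} (he : e ∈ m.divisors) :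
    (-x).ghost e = -x.ghost e := by
  refine (ghost_ofFun _ he).trans ?_
  rw [ghostSum_aeval, ghostSum_negPoly (ne_zero_of_mem he), map_neg, ← ghostSum_aeval]
  simp [ghost]

/-- The map on big Witt vectors induced by a ring homomorphism, as a function. -/
def mapFun (f : R →+* S) (x : BigWitt m R) : BigWitt m S := ⟨fun e => f (x.toFun e)⟩

theorem coeff_mapFun (f : R →+* S) (x : BigWitt m R) (e : ℕ) :
    (mapFun f x).coeff e = f (x.coeff e) := by
  unfold coeff mapFun
  split_ifs <;> simp

theorem mapFun_ofFun (f : R →+* S) (g : ℕ → R) :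
    mapFun f (ofFun m g) = ofFun m fun e => f (g e) := rfl

theorem map_aeval_int {σ : Type*} (f : R →+* S) (v : σ → R) (P : MvPolynomial σ ℤ) :
    f (MvPolynomial.aeval v P) = MvPolynomial.aeval (fun i => f (v i)) P :=
  DFunLike.congr_fun (MvPolynomial.comp_aeval v f.toIntAlgHom) P

theorem mapFun_zero (f : R →+* S) : mapFun f (0 : BigWitt m R) = 0 := by
  refine (mapFun_ofFun f _).trans ?_
  simp only [map_zero]
  rfl

theorem mapFun_one (f : R →+* S) : mapFun f (1 : BigWitt m R) = 1 := by
  refine (mapFun_ofFun f _).trans ?_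
  simp only [apply_ite f, map_zero, map_one]
  rfl

theorem map_pair (f : R →+* S) (x y : BigWitt m R) :
    (fun i => f (pair x y i)) = pair (mapFun f x) (mapFun f y) := by
  funext ⟨b, i⟩
  cases b <;> simp [pair, coeff_mapFun]

theorem mapFun_add (f : R →+* S) (x y : BigWitt m R) :
    mapFun f (x + y) = mapFun f x + mapFun f y := by
  refine (mapFun_ofFun f _).trans ?_
  simp only [map_aeval_int, map_pair]
  rfl

theorem mapFun_mul (f : R →+* S) (x y : BigWitt m R) :
    mapFun f (x * y) = mapFun f x * mapFun f y := by
  refine (mapFun_ofFun f _).trans ?_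
  simp only [map_aeval_int, map_pair]
  rfl

theorem mapFun_neg (f : R →+* S) (x : BigWitt m R) : mapFun f (-x) = -mapFun f x := by
  refine (mapFun_ofFun f _).trans ?_
  simp only [map_aeval_int, ← coeff_mapFun]
  rfl

/-- The tautological surjection onto `R` from a polynomial ring over `ℤ`. -/
noncomputable def cover (R : Type*) [CommRing R] : MvPolynomial R ℤ →+* R :=
  (MvPolynomial.aeval (fun r : R => r) : MvPolynomial R ℤ →ₐ[ℤ] R).toRingHom

theorem mapFun_cover_surjective :
    Function.Surjective (mapFun (cover R) : BigWitt m (MvPolynomial R ℤ) → BigWitt m R) := by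
  intro x
  refine ⟨⟨fun e => MvPolynomial.X (x.toFun e)⟩, ?_⟩
  ext e
  simp [mapFun, cover]

theorem mapFun_cover_congr {x y : BigWitt m (MvPolynomial R ℤ)}
    (h : ∀ e ∈ m.divisors, x.ghost e = y.ghost e) : mapFun (cover R) x = mapFun (cover R) y :=
  congrArg _ (ext_ghost h)

noncomputable instance : CommRing (BigWitt m R) where
  add_assoc x y z := by
    obtain ⟨x, rfl⟩ := mapFun_cover_surjective x
    obtain ⟨y, rfl⟩ := mapFun_cover_surjective y
    obtain ⟨z, rfl⟩ := mapFun_cover_surjective z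
    simp only [← mapFun_add]
    exact mapFun_cover_congr fun e he => by simp only [ghost_add _ _ he, add_assoc]
  zero_add x := by
    obtain ⟨x, rfl⟩ := mapFun_cover_surjective x
    simp only [← mapFun_zero (cover R), ← mapFun_add]
    exact mapFun_cover_congr fun e he => by simp only [ghost_add _ _ he, ghost_zero he, zero_add]
  add_zero x := by
    obtain ⟨x, rfl⟩ := mapFun_cover_surjective x
    simp only [← mapFun_zero (cover R), ← mapFun_add]
    exact mapFun_cover_congr fun e he => by simp only [ghost_add _ _ he, ghost_zero he, add_zero]
  nsmul := nsmulRec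
  zsmul := zsmulRec
  neg_add_cancel x := by
    obtain ⟨x, rfl⟩ := mapFun_cover_surjective x
    simp only [← mapFun_zero (cover R), ← mapFun_add, ← mapFun_neg]
    exact mapFun_cover_congr fun e he => by
      simp only [ghost_add _ _ he, ghost_neg _ he, ghost_zero he, neg_add_cancel]
  add_comm x y := by
    obtain ⟨x, rfl⟩ := mapFun_cover_surjective x
    obtain ⟨y, rfl⟩ := mapFun_cover_surjective y
    simp only [← mapFun_add]
    exact mapFun_cover_congr fun e he => by simp only [ghost_add _ _ he, add_comm]
  left_distrib x y z := by
    obtain ⟨x, rfl⟩ := mapFun_cover_surjective x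
    obtain ⟨y, rfl⟩ := mapFun_cover_surjective y
    obtain ⟨z, rfl⟩ := mapFun_cover_surjective z
    simp only [← mapFun_add, ← mapFun_mul]
    exact mapFun_cover_congr fun e he => by simp only [ghost_add _ _ he, ghost_mul _ _ he, mul_add]
  right_distrib x y z := by
    obtain ⟨x, rfl⟩ := mapFun_cover_surjective x
    obtain ⟨y, rfl⟩ := mapFun_cover_surjective y
    obtain ⟨z, rfl⟩ := mapFun_cover_surjective z
    simp only [← mapFun_add, ← mapFun_mul]
    exact mapFun_cover_congr fun e he => by simp only [ghost_add _ _ he, ghost_mul _ _ he, add_mul]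
  zero_mul x := by
    obtain ⟨x, rfl⟩ := mapFun_cover_surjective x
    simp only [← mapFun_zero (cover R), ← mapFun_mul]
    exact mapFun_cover_congr fun e he => by simp only [ghost_mul _ _ he, ghost_zero he, zero_mul]
  mul_zero x := by
    obtain ⟨x, rfl⟩ := mapFun_cover_surjective x
    simp only [← mapFun_zero (cover R), ← mapFun_mul]
    exact mapFun_cover_congr fun e he => by simp only [ghost_mul _ _ he, ghost_zero he, mul_zero]
  mul_assoc x y z := by
    obtain ⟨x, rfl⟩ := mapFun_cover_surjective x
    obtain ⟨y, rfl⟩ := mapFun_cover_surjective y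
    obtain ⟨z, rfl⟩ := mapFun_cover_surjective z
    simp only [← mapFun_mul]
    exact mapFun_cover_congr fun e he => by simp only [ghost_mul _ _ he, mul_assoc]
  one_mul x := by
    obtain ⟨x, rfl⟩ := mapFun_cover_surjective x
    simp only [← mapFun_one (cover R), ← mapFun_mul]
    exact mapFun_cover_congr fun e he => by simp only [ghost_mul _ _ he, ghost_one he, one_mul]
  mul_one x := by
    obtain ⟨x, rfl⟩ := mapFun_cover_surjective x
    simp only [← mapFun_one (cover R), ← mapFun_mul]
    exact mapFun_cover_congr fun e he => by simp only [ghost_mul _ _ he, ghost_one he, mul_one]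
  mul_comm x y := by
    obtain ⟨x, rfl⟩ := mapFun_cover_surjective x
    obtain ⟨y, rfl⟩ := mapFun_cover_surjective y
    simp only [← mapFun_mul]
    exact mapFun_cover_congr fun e he => by simp only [ghost_mul _ _ he, mul_comm]

/-- The ring homomorphism on big Witt vectors induced by a ring homomorphism, coordinatewise in
Witt coordinates. -/
noncomputable def map (m : ℕ) (f : R →+* S) : BigWitt m R →+* BigWitt m S where
  toFun := mapFun f
  map_zero' := mapFun_zero f
  map_one' := mapFun_one f
  map_add' := mapFun_add f
  map_mul' := mapFun_mul f

/-- The `e`-th ghost coordinate, for `e ∣ m`, as a ring homomorphism. -/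
noncomputable def ghostHom (R : Type*) [CommRing R] {m e : ℕ} (he : e ∈ m.divisors) :
    BigWitt m R →+* R where
  toFun x := x.ghost e
  map_zero' := ghost_zero he
  map_one' := ghost_one he
  map_add' x y := ghost_add x y he
  map_mul' x y := ghost_mul x y he

/-- The Frobenius `F_{n/m} : W_n(R) → W_m(R)`, for `m ∣ n`. It is given by the universal polynomials
for which the `e`-th ghost coordinate of the image of `x` is the `(n/m) * e`-th ghost coordinate
of `x`. -/
noncomputable def frobenius (m n : ℕ) (x : BigWitt n R) : BigWitt m R :=
  ofFun m fun e => MvPolynomial.aeval x.coeff (frobPoly (n / m) e)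

/-- The Verschiebung `V_{n/m} : W_m(R) → W_n(R)`, for `m ∣ n`: the `e`-th Witt coordinate of the
image of `x` is `x_{e / (n/m)}` if `n/m` divides `e`, and `0` otherwise. -/
def verschiebung (m n : ℕ) (x : BigWitt m R) : BigWitt n R :=
  ofFun n fun e => if n / m ∣ e then x.coeff (e / (n / m)) else 0

theorem ghost_frobenius {m n : ℕ} (hmn : m ∣ n) (hn : n ≠ 0) (x : BigWitt n R) {e : ℕ}
    (he : e ∈ m.divisors) : (frobenius m n x).ghost e = x.ghost (n / m * e) := by
  have hd : n / m ≠ 0 := (Nat.div_pos (Nat.le_of_dvd (Nat.pos_of_ne_zero hn) hmn)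
    (Nat.pos_of_dvd_of_pos hmn (Nat.pos_of_ne_zero hn))).ne'
  refine (ghost_ofFun _ he).trans ?_
  rw [ghostSum_aeval, ghostSum_frobPoly hd (ne_zero_of_mem he), ← ghostSum_aeval]
  simp [ghost]

theorem ghost_verschiebung {m n : ℕ} (hmn : m ∣ n) (x : BigWitt m R) {e : ℕ}
    (he : e ∈ n.divisors) : (verschiebung m n x).ghost e =
      if n / m ∣ e then ((n / m : ℕ) : R) * x.ghost (e / (n / m)) else 0 := by
  have hn := (Nat.mem_divisors.mp he).2
  have hd : 0 < n / m := Nat.div_pos (Nat.le_of_dvd (Nat.pos_of_ne_zero hn) hmn)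
    (Nat.pos_of_dvd_of_pos hmn (Nat.pos_of_ne_zero hn))
  refine (ghost_ofFun _ he).trans ?_
  generalize n / m = d at hd
  have hterm : ∀ k ∈ e.divisors, ¬ d ∣ k →
      (k : R) * (if d ∣ k then x.coeff (k / d) else 0) ^ (e / k) = 0 := by
    intro k hk hdk
    rw [if_neg hdk, zero_pow, mul_zero]
    exact (Nat.div_pos (Nat.divisor_le hk) (Nat.pos_of_mem_divisors hk)).ne'
  split_ifs with hde
  · obtain ⟨f, rfl⟩ := hde
    have hf : f ≠ 0 := right_ne_zero_of_mul (ne_zero_of_mem he)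
    rw [Nat.mul_div_cancel_left _ hd, ghost, ghostSum, ghostSum, Finset.mul_sum]
    symm
    refine Finset.sum_of_injOn (fun k => d * k) ?_ ?_ ?_ ?_
    · intro a _ b _ h
      exact Nat.eq_of_mul_eq_mul_left hd h
    · intro k hk
      simp only [Finset.mem_coe, Nat.mem_divisors] at hk ⊢
      exact ⟨Nat.mul_dvd_mul_left d hk.1, mul_ne_zero hd.ne' hf⟩
    · intro k hk hk'
      refine hterm k hk fun hdk => hk' ?_
      obtain ⟨l, rfl⟩ := hdk
      refine ⟨l, ?_, rfl⟩
      simp only [Finset.mem_coe, Nat.mem_divisors]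
      exact ⟨Nat.dvd_of_mul_dvd_mul_left hd (Nat.dvd_of_mem_divisors hk), hf⟩
    · intro k _
      simp only [dvd_mul_right, if_true]
      rw [Nat.mul_div_cancel_left _ hd, Nat.mul_div_mul_left _ _ hd]
      push_cast
      ring
  · refine Finset.sum_eq_zero fun k hk => hterm k hk fun hdk => hde ?_
    exact hdk.trans (Nat.dvd_of_mem_divisors hk)

theorem map_frobenius (f : R →+* S) (m n : ℕ) (x : BigWitt n R) :
    map m f (frobenius m n x) = frobenius m n (map n f x) := by
  refine (mapFun_ofFun f _).trans ?_
  simp only [map_aeval_int, ← coeff_mapFun]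
  rfl

theorem map_verschiebung (f : R →+* S) (m n : ℕ) (x : BigWitt m R) :
    map n f (verschiebung m n x) = verschiebung m n (map m f x) := by
  refine (mapFun_ofFun f _).trans ?_
  simp only [apply_ite f, map_zero, ← coeff_mapFun]
  rfl

theorem ghost_map (f : R →+* S) (x : BigWitt m R) (e : ℕ) :
    (map m f x).ghost e = f (x.ghost e) := by
  refine Eq.trans ?_ (map_ghostSum f x.coeff e).symm
  simp only [← coeff_mapFun]
  rfl

end BigWitt

/-- The ideal of `W_m(R)[q]` generated by the elements `(q^e - 1) V_{m/e}(x)`, for `e ∣ m` and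
`x ∈ W_e(R)`, and `[e/d]_{q^d} V_{m/e}(x) - V_{m/d}(F_{e/d}(x))`, for `d ∣ e ∣ m` and `x ∈ W_e(R)`.
The polynomial variable is `q`. -/
noncomputable def qWittIdeal (m : ℕ) (R : Type*) [CommRing R] : Ideal (BigWitt m R)[X] :=
  Ideal.span
    ({f | ∃ e, e ∣ m ∧ ∃ x : BigWitt e R, f = (X ^ e - 1) * C (BigWitt.verschiebung e m x)} ∪
     {f | ∃ d e, d ∣ e ∧ e ∣ m ∧ ∃ x : BigWitt e R,
        f = (∑ i ∈ Finset.range (e / d), (X ^ d) ^ i) * C (BigWitt.verschiebung e m x) -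
          C (BigWitt.verschiebung d m (BigWitt.frobenius d e x))})

/-- The `m`-truncated big `q`-Witt vectors of `R`. -/
abbrev QWitt (m : ℕ) (R : Type*) [CommRing R] : Type _ := (BigWitt m R)[X] ⧸ qWittIdeal m R

namespace QWitt

variable {R S : Type*} [CommRing R] [CommRing S]

theorem qWittIdeal_le_comap (m : ℕ) (f : R →+* S) :
    qWittIdeal m R ≤ (qWittIdeal m S).comap (mapRingHom (BigWitt.map m f)) := by
  rw [qWittIdeal, Ideal.span_le]
  rintro _ (⟨e, he, x, rfl⟩ | ⟨d, e, hde, he, x, rfl⟩)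
  · refine Ideal.subset_span (Or.inl ⟨e, he, BigWitt.map e f x, ?_⟩)
    simp [BigWitt.map_verschiebung]
  · refine Ideal.subset_span (Or.inr ⟨d, e, hde, he, BigWitt.map e f x, ?_⟩)
    simp [BigWitt.map_verschiebung, BigWitt.map_frobenius, Polynomial.map_sum]

/-- Functoriality of big `q`-Witt vectors. -/
noncomputable def map (m : ℕ) (f : R →+* S) : QWitt m R →+* QWitt m S :=
  Ideal.quotientMap (qWittIdeal m S) (mapRingHom (BigWitt.map m f)) (qWittIdeal_le_comap m f)

theorem div_mem_divisors {m e : ℕ} (he : e ∈ m.divisors) : m / e ∈ m.divisors :=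
  Nat.mem_divisors.mpr
    ⟨Nat.div_dvd_of_dvd (Nat.dvd_of_mem_divisors he), (Nat.mem_divisors.mp he).2⟩

/-- The `ℤ[q]`-algebra map `W_m(R)[q] → R[q]/Φ_e(q)` given by the `(m/e)`-th ghost coordinate on
`W_m(R)`. -/
noncomputable def preGhost (R : Type*) [CommRing R] {m e : ℕ} (he : e ∈ m.divisors) :
    (BigWitt m R)[X] →+* AdjoinRoot (cyclotomic e R) :=
  (AdjoinRoot.mk (cyclotomic e R)).comp
    (mapRingHom (BigWitt.ghostHom R (div_mem_divisors he)))

theorem preGhost_X {m e : ℕ} (he : e ∈ m.divisors) :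
    preGhost R he X = AdjoinRoot.root (cyclotomic e R) := by
  simp [preGhost]

theorem preGhost_C {m e : ℕ} (he : e ∈ m.divisors) (x : BigWitt m R) :
    preGhost R he (C x) = AdjoinRoot.of (cyclotomic e R) (x.ghost (m / e)) := by
  simp [preGhost, BigWitt.ghostHom]

theorem root_pow_eq_one {e n : ℕ} (h : e ∣ n) :
    AdjoinRoot.root (cyclotomic e R) ^ n = 1 := by
  have h1 : cyclotomic e R ∣ X ^ n - 1 :=
    (cyclotomic.dvd_X_pow_sub_one e R).trans (by
      obtain ⟨k, rfl⟩ := h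
      rw [pow_mul]
      simpa using sub_dvd_pow_sub_pow (X ^ e : R[X]) 1 k)
  have h2 := AdjoinRoot.mk_eq_zero.mpr h1
  rw [map_sub, map_pow, AdjoinRoot.mk_X, map_one] at h2
  exact sub_eq_zero.mp h2

theorem geom_sum_root_eq_zero {c d k : ℕ} (hc : c ∣ d * k) (hcd : ¬ c ∣ d) (hdk : d * k ≠ 0) :
    ∑ i ∈ Finset.range k, (AdjoinRoot.root (cyclotomic c R) ^ d) ^ i = 0 := by
  have hdvd : cyclotomic c ℤ ∣ ∑ i ∈ Finset.range k, (X ^ d) ^ i := by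
    have hprod : (cyclotomic c ℤ) ∣ (∑ i ∈ Finset.range k, (X ^ d) ^ i) * (X ^ d - 1) := by
      rw [geom_sum_mul, ← pow_mul]
      rw [← prod_cyclotomic_eq_X_pow_sub_one (Nat.pos_of_ne_zero hdk) ℤ]
      exact Finset.dvd_prod_of_mem _ (Nat.mem_divisors.mpr ⟨hc, hdk⟩)
    have hc0 : 0 < c := Nat.pos_of_dvd_of_pos hc (Nat.pos_of_ne_zero hdk)
    have hd0 : 0 < d := Nat.pos_of_ne_zero (left_ne_zero_of_mul hdk)
    have hirr := (cyclotomic.irreducible hc0).prime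
    refine (hirr.dvd_or_dvd hprod).resolve_right fun h => hcd ?_
    rw [← prod_cyclotomic_eq_X_pow_sub_one hd0 ℤ] at h
    obtain ⟨b, hb, hcb⟩ := (hirr.dvd_finsetProd_iff _).mp h
    have hb0 := Nat.pos_of_mem_divisors hb
    have := eq_of_monic_of_associated (cyclotomic.monic c ℤ) (cyclotomic.monic b ℤ)
      ((cyclotomic.irreducible hc0).associated_of_dvd (cyclotomic.irreducible hb0) hcb)
    rw [cyclotomic_injective this]
    exact Nat.dvd_of_mem_divisors hb
  have h1 := Polynomial.map_dvd (Int.castRingHom R) hdvd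
  rw [map_cyclotomic, Polynomial.map_sum] at h1
  have h2 := AdjoinRoot.mk_eq_zero.mpr h1
  simpa using h2

theorem div_dvd_div_iff_of_dvd {m c e : ℕ} (hm : m ≠ 0) (hc : c ∣ m) (he : e ∣ m) :
    m / e ∣ m / c ↔ c ∣ e := by
  obtain ⟨a, rfl⟩ := he
  have he0 : 0 < e := Nat.pos_of_ne_zero (left_ne_zero_of_mul hm)
  have ha0 : 0 < a := Nat.pos_of_ne_zero (right_ne_zero_of_mul hm)
  have hc0 : 0 < c := Nat.pos_of_dvd_of_pos hc (Nat.pos_of_ne_zero hm)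
  rw [Nat.mul_div_cancel_left _ he0, Nat.dvd_div_iff_mul_dvd hc,
    Nat.mul_dvd_mul_iff_right ha0]

theorem ghost_verschiebung_div {m c e : ℕ} (hc : c ∈ m.divisors) (he : e ∣ m)
    (x : BigWitt e R) : (BigWitt.verschiebung e m x).ghost (m / c) =
      if c ∣ e then ((m / e : ℕ) : R) * x.ghost (e / c) else 0 := by
  have hm := (Nat.mem_divisors.mp hc).2
  have hcm := Nat.dvd_of_mem_divisors hc
  rw [BigWitt.ghost_verschiebung he x (div_mem_divisors hc)]
  simp only [div_dvd_div_iff_of_dvd hm hcm he]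
  split_ifs with hce
  · obtain ⟨a, rfl⟩ := he
    obtain ⟨b, rfl⟩ := hce
    have h0 := Nat.pos_of_ne_zero hm
    have ha : 0 < a := Nat.pos_of_mul_pos_left h0
    have hcb : 0 < c * b := Nat.pos_of_mul_pos_right h0
    have hc0 : 0 < c := Nat.pos_of_mul_pos_right hcb
    rw [Nat.mul_div_cancel_left _ hcb, mul_assoc, Nat.mul_div_cancel_left _ hc0,
      Nat.mul_div_cancel_left _ hc0, Nat.mul_div_cancel _ ha]
  · rfl

theorem preGhost_eq_zero {m e : ℕ} (he : e ∈ m.divisors) (f : (BigWitt m R)[X])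
    (hf : f ∈ qWittIdeal m R) : preGhost R he f = 0 := by
  suffices h : qWittIdeal m R ≤ RingHom.ker (preGhost R he) from h hf
  have hm := (Nat.mem_divisors.mp he).2
  rw [qWittIdeal, Ideal.span_le]
  rintro _ (⟨b, hb, x, rfl⟩ | ⟨d, b, hdb, hb, x, rfl⟩)
  · simp only [SetLike.mem_coe, RingHom.mem_ker, map_mul, map_sub, map_pow, map_one, preGhost_X,
      preGhost_C, ghost_verschiebung_div he hb]
    split_ifs with h
    · rw [root_pow_eq_one h, sub_self, zero_mul]
    · rw [map_zero, mul_zero]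
  · simp only [SetLike.mem_coe, RingHom.mem_ker, map_mul, map_sub, map_pow, map_sum, preGhost_X,
      preGhost_C, ghost_verschiebung_div he hb, ghost_verschiebung_div he (hdb.trans hb)]
    have hb0 := ne_zero_of_dvd_ne_zero hm hb
    obtain ⟨k, rfl⟩ := hdb
    have hd0 : 0 < d := Nat.pos_of_ne_zero (left_ne_zero_of_mul hb0)
    have hk0 : 0 < k := Nat.pos_of_ne_zero (right_ne_zero_of_mul hb0)
    rw [Nat.mul_div_cancel_left _ hd0]
    by_cases h : e ∣ d
    · rw [if_pos h, if_pos (h.mul_right k), root_pow_eq_one h,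
        BigWitt.ghost_frobenius (Dvd.intro k rfl) hb0 x
          (div_mem_divisors (Nat.mem_divisors.mpr ⟨h, hd0.ne'⟩))]
      obtain ⟨a, rfl⟩ := hb
      have he0 : 0 < e := Nat.pos_of_dvd_of_pos h hd0
      have hdiv : d * k / e = k * (d / e) := by rw [mul_comm d k, Nat.mul_div_assoc k h]
      rw [Nat.mul_div_cancel_left _ (Nat.pos_of_ne_zero hb0), mul_assoc d k a,
        Nat.mul_div_cancel_left _ hd0, Nat.mul_div_cancel_left _ hd0, hdiv]
      simp only [one_pow, Finset.sum_const, Finset.card_range, map_mul, map_natCast,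
        nsmul_eq_mul, Nat.cast_mul]
      ring
    · rw [if_neg h, map_zero, sub_zero]
      split_ifs with h'
      · rw [geom_sum_root_eq_zero h' h hb0, zero_mul]
      · rw [map_zero, mul_zero]

/-- The `e`-th `q`-ghost coordinate `q-W_m(R) → R[q]/Φ_e(q)`, for `e ∣ m`. -/
noncomputable def ghostCoord (R : Type*) [CommRing R] {m e : ℕ} (he : e ∈ m.divisors) :
    QWitt m R →+* AdjoinRoot (cyclotomic e R) :=
  Ideal.Quotient.lift (qWittIdeal m R) (preGhost R he) (preGhost_eq_zero he)

/-- The `q`-ghost map `q-W_m(R) → ∏_{e ∣ m} R[q]/Φ_e(q)`. -/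
noncomputable def ghost (m : ℕ) (R : Type*) [CommRing R] :
    QWitt m R →+* ∀ e : m.divisors, AdjoinRoot (cyclotomic (e : ℕ) R) :=
  RingHom.pi fun e => ghostCoord R e.2

theorem cyclotomic_subst (R : Type*) [CommRing R] {g e : ℕ} (hge : g ∣ e) (he : 0 < e) :
    (cyclotomic g R).eval₂ (AdjoinRoot.of (cyclotomic e R))
      (AdjoinRoot.root (cyclotomic e R) ^ (e / g)) = 0 := by
  have hg : 0 < g := Nat.pos_of_dvd_of_pos hge he
  have hdvd : cyclotomic e ℤ ∣ expand ℤ (e / g) (cyclotomic g ℤ) := by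
    have hζ := Complex.isPrimitiveRoot_exp e he.ne'
    rw [cyclotomic_eq_minpoly hζ he]
    refine minpoly.isIntegrallyClosed_dvd (hζ.isIntegral he) ?_
    have hp := hζ.pow he (Nat.div_mul_cancel hge).symm
    rw [expand_aeval, ← eval_map_algebraMap, algebraMap_int_eq, map_cyclotomic]
    have := NeZero.of_pos hg
    exact (isRoot_cyclotomic_iff.mpr hp)
  have h1 := Polynomial.map_dvd (Int.castRingHom R) hdvd
  rw [map_cyclotomic, map_expand, map_cyclotomic] at h1
  have h2 := AdjoinRoot.mk_eq_zero.mpr h1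
  rw [← AdjoinRoot.aeval_eq, expand_aeval, aeval_def] at h2
  exact h2

/-- The map `R[q]/Φ_g(q) → R[q]/Φ_e(q)`, `c(q) ↦ c(q^(e/g))`, for `g ∣ e`. -/
noncomputable def subst (R : Type*) [CommRing R] {g e : ℕ} (hge : g ∣ e) (he : 0 < e) :
    AdjoinRoot (cyclotomic g R) →+* AdjoinRoot (cyclotomic e R) :=
  AdjoinRoot.lift (AdjoinRoot.of (cyclotomic e R)) (AdjoinRoot.root (cyclotomic e R) ^ (e / g))
    (cyclotomic_subst R hge he)

theorem gcd_mem_divisors {m m' : ℕ} (h : m ∣ m') (e : m'.divisors) :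
    Nat.gcd e m ∈ m.divisors :=
  Nat.mem_divisors.mpr ⟨Nat.gcd_dvd_right _ _,
    ne_zero_of_dvd_ne_zero (Nat.mem_divisors.mp e.2).2 h⟩

/-- The formula for the cyclotomic norm in `q`-ghost coordinates:
`(c_e(q))_{e ∣ m} ↦ (c_{(e,m)}(q^{e/(e,m)})^{m'/[e,m]})_{e ∣ m'}`. -/
noncomputable def ghostNorm (R : Type*) [CommRing R] {m m' : ℕ} (h : m ∣ m')
    (c : ∀ e : m.divisors, AdjoinRoot (cyclotomic (e : ℕ) R)) (e : m'.divisors) :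
    AdjoinRoot (cyclotomic (e : ℕ) R) :=
  subst R (Nat.gcd_dvd_left (e : ℕ) m) (Nat.pos_of_mem_divisors e.2)
    (c ⟨Nat.gcd e m, gcd_mem_divisors h e⟩) ^ (m' / Nat.lcm e m)

end QWitt

/-!
Over a torsion-free ring the `q`-ghost map is injective: filtering `q-W_m(R)` by the images of the
Verschiebungen `V_{m/e}`, the `e`-th `q`-ghost coordinate detects the `e`-th graded piece. There a
norm is therefore unique once it exists, and norms are multiplicative and natural.

Norms exist over every ring. They compose, so it suffices to go from `m` to `p * m` with `p` prime,
where the formula reads `c_e(q) ^ p` for `e ∣ m` and `c_{e/p}(q ^ p)` otherwise. On Witt vectors the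
corresponding ghost sequence satisfies Dwork's congruences, `q` has the norm `q ^ p`, and sums are
handled because `(c + d) ^ p - c ^ p - d ^ p` is divisible by `p`.

A general `R` is a quotient of the torsion-free ring `ℤ[R]`. Two lifts of a `q`-Witt vector to
`ℤ[R]` come from a single one over the kernel pair `ℤ[R] ×_R ℤ[R]`, which is again torsion-free, so
their norms have the same image over `R`.
-/

namespace BigWitt

section PrimeNorm

variable {A : Type*} [CommRing A] {φ : ℕ → A →+* A} {p : ℕ}

/-- Dwork's congruences for a family `g`, with respect to lifts `φ p` of the Frobenius maps. Over a
ring with such lifts they characterise the families of ghost coordinates of big Witt vectors. -/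
def DworkCongruences (φ : ℕ → A →+* A) (g : ℕ → A) : Prop :=
  ∀ p e : ℕ, p.Prime → e ≠ 0 → p ∣ e → (p : A) ^ e.factorization p ∣ g e - φ p (g (e / p))

/-- The ghost coordinates of the norm along a prime `p` of a Witt vector with ghost coordinates
`g`. -/
def normSeq (p : ℕ) (g : ℕ → A) (e : ℕ) : A := if p ∣ e then g (e / p) ^ p else g e

theorem map_normSeq {B : Type*} [CommRing B] (f : A →+* B) (p : ℕ) (g : ℕ → A) (e : ℕ) :
    f (normSeq p g e) = normSeq p (fun d => f (g d)) e := by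
  simp only [normSeq, apply_ite f, map_pow]

theorem normSeq_mul_left (hp : 0 < p) (g : ℕ → A) (f : ℕ) : normSeq p g (p * f) = g f ^ p := by
  rw [normSeq, if_pos (dvd_mul_right p f), Nat.mul_div_cancel_left _ hp]

theorem pow_succ_dvd_pow_sub_pow {v : ℕ} (hv : v ≠ 0) {a b : A} (h : (p : A) ^ v ∣ a - b) :
    (p : A) ^ (v + 1) ∣ a ^ p - b ^ p := by
  rw [← (Commute.all a b).mul_geom_sum₂ p, pow_succ]
  exact mul_dvd_mul h (dvd_geom_sum₂_self ((dvd_pow_self _ hv).trans h))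

theorem dworkCongruences_normSeq (hp : p.Prime) {g : ℕ → A} (hg : DworkCongruences φ g)
    (hφ : ∀ a, (p : A) ∣ a ^ p - φ p a) : DworkCongruences φ (normSeq p g) := by
  intro l e hl he hle
  by_cases hpe : p ∣ e
  · obtain ⟨f, rfl⟩ := hpe
    have hf : f ≠ 0 := right_ne_zero_of_mul he
    rw [normSeq_mul_left hp.pos, Nat.factorization_mul hp.ne_zero hf, Finsupp.add_apply]
    obtain rfl | hlp := eq_or_ne l p
    · rw [hp.factorization_self, Nat.mul_div_cancel_left _ hp.pos, add_comm]
      by_cases hlf : l ∣ f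
      · rw [normSeq, if_pos hlf, map_pow]
        exact pow_succ_dvd_pow_sub_pow (hp.factorization_pos_of_dvd hf hlf).ne'
          (hg l f hl hf hlf)
      · rw [normSeq, if_neg hlf, Nat.factorization_eq_zero_of_not_dvd hlf, zero_add,
          pow_one]
        exact hφ _
    · have hlf : l ∣ f := (hl.dvd_mul.mp hle).resolve_left
        fun h => hlp ((Nat.prime_dvd_prime_iff_eq hl hp).mp h)
      rw [Nat.mul_div_assoc _ hlf, normSeq_mul_left hp.pos, map_pow,
        Nat.factorization_eq_zero_of_not_dvd (mt (Nat.prime_dvd_prime_iff_eq hl hp).mp hlp),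
        zero_add]
      exact (hg l f hl hf hlf).trans (sub_dvd_pow_sub_pow _ _ p)
  · have hpe' : ¬ p ∣ e / l := fun h => hpe (h.trans (Nat.div_dvd_of_dvd hle))
    rw [normSeq, normSeq, if_neg hpe, if_neg hpe']
    exact hg l e hl he hle

/-- Universal polynomials of the norm of big Witt vectors along a prime `p`. -/
noncomputable def normPoly (p : ℕ) : ℕ → MvPolynomial ℕ ℤ :=
  solve (normSeq p (ghostSum MvPolynomial.X))

theorem ghostSum_normPoly (hp : p.Prime) {e : ℕ} (he : e ≠ 0) :
    ghostSum (normPoly p) e = normSeq p (ghostSum MvPolynomial.X) e :=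
  have hX : DworkCongruences
      (fun p => (MvPolynomial.expand p : MvPolynomial ℕ ℤ →ₐ[ℤ] _).toRingHom)
      (ghostSum MvPolynomial.X) :=
    fun _ _ hl he hle => ghostSum_dwork expand_frobenius _ hl he hle
  have hnorm := dworkCongruences_normSeq hp hX (expand_frobenius p hp)
  ghostSum_solve expand_frobenius hnorm he

end PrimeNorm

variable {m : ℕ} {R S : Type*} [CommRing R] [CommRing S]

/-- The norm of big Witt vectors along a prime `p`. It is the multiplicative map whose effect on
ghost coordinates is `normSeq`. -/
noncomputable def primeNorm (p : ℕ) (x : BigWitt m R) : BigWitt (p * m) R :=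
  ofFun (p * m) fun e => MvPolynomial.aeval x.coeff (normPoly p e)

theorem ghost_primeNorm {p : ℕ} (hp : p.Prime) (x : BigWitt m R) {e : ℕ}
    (he : e ∈ (p * m).divisors) : (primeNorm p x).ghost e = normSeq p x.ghost e := by
  refine (ghost_ofFun _ he).trans ?_
  rw [ghostSum_aeval, ghostSum_normPoly hp (ne_zero_of_mem he)]
  refine (map_normSeq (MvPolynomial.aeval x.coeff : _ →ₐ[ℤ] R).toRingHom p _ e).trans ?_
  congr 1
  funext d
  exact (map_ghostSum _ _ _).trans (congrArg (ghostSum · d) (funext fun i => by simp))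

theorem coeff_map (f : R →+* S) (x : BigWitt m R) (e : ℕ) :
    (map m f x).coeff e = f (x.coeff e) := coeff_mapFun f x e

theorem map_surjective {f : R →+* S} (hf : Function.Surjective f) :
    Function.Surjective (map m f) := by
  intro y
  choose g hg using hf
  exact ⟨⟨fun e => g (y.toFun e)⟩, BigWitt.ext (funext fun e => hg (y.toFun e))⟩

theorem cover_surjective : Function.Surjective (cover R) :=
  fun r => ⟨MvPolynomial.X r, by simp [cover]⟩

theorem map_cover_surjective : Function.Surjective (map m (cover R)) :=
  map_surjective cover_surjective

theorem ghost_at_one (x : BigWitt m R) : x.ghost 1 = x.coeff 1 := by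
  simp [ghost, ghostSum]

theorem ghost_sum {ι : Type*} (s : Finset ι) (x : ι → BigWitt m R) {e : ℕ} (he : e ∈ m.divisors) :
    (∑ i ∈ s, x i).ghost e = ∑ i ∈ s, (x i).ghost e :=
  map_sum (ghostHom R he) x s

/-- The Teichmüller representative of `r`. -/
def teichmuller (m : ℕ) (r : R) : BigWitt m R := ofFun m fun e => if e = 1 then r else 0

theorem map_teichmuller (f : R →+* S) (r : R) :
    map m f (teichmuller m r) = teichmuller m (f r) := by
  refine (mapFun_ofFun f _).trans ?_
  simp only [apply_ite f, map_zero]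
  rfl

theorem ghost_teichmuller (r : R) {e : ℕ} (he : e ∈ m.divisors) :
    (teichmuller m r).ghost e = r ^ e := by
  refine (ghost_ofFun _ he).trans ?_
  rw [ghostSum, Finset.sum_eq_single_of_mem 1 (Nat.one_mem_divisors.mpr (ne_zero_of_mem he))]
  · simp
  · intro d hd hd1
    rw [if_neg hd1, zero_pow (Nat.div_pos (Nat.divisor_le hd) (Nat.pos_of_mem_divisors hd)).ne',
      mul_zero]

theorem teichmuller_zero : teichmuller m (0 : R) = 0 := by
  simp only [teichmuller, ite_self]
  rfl

theorem ext_ghost_div [IsDomain R] [CharZero R] {x y : BigWitt m R}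
    (h : ∀ c ∈ m.divisors, x.ghost (m / c) = y.ghost (m / c)) : x = y :=
  ext_ghost fun e he => by
    have hm := Nat.mem_divisors.mp he
    simpa only [Nat.div_div_self hm.1 hm.2] using h (m / e) (QWitt.div_mem_divisors he)

theorem verschiebung_self (hm : m ≠ 0) (x : BigWitt m R) : verschiebung m m x = x :=
  ext_coeff fun e he => by
    simp [verschiebung, coeff_ofFun _ he, Nat.div_self (Nat.pos_of_ne_zero hm)]

theorem verschiebung_verschiebung {d e : ℕ} (hde : d ∣ e) (hem : e ∣ m) (x : BigWitt d R) :
    verschiebung e m (verschiebung d e x) = verschiebung d m x := by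
  obtain ⟨x, rfl⟩ := map_cover_surjective x
  simp only [← map_verschiebung]
  congr 1
  refine ext_ghost_div fun c hc => ?_
  have he : e ≠ 0 := ne_zero_of_dvd_ne_zero (Nat.mem_divisors.mp hc).2 hem
  rw [QWitt.ghost_verschiebung_div hc hem, QWitt.ghost_verschiebung_div hc (hde.trans hem)]
  by_cases hce : c ∣ e
  · rw [if_pos hce, QWitt.ghost_verschiebung_div (Nat.mem_divisors.mpr ⟨hce, he⟩) hde, mul_ite,
      mul_zero, ← mul_assoc, ← Nat.cast_mul, Nat.div_mul_div hem hde]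
  · rw [if_neg hce, if_neg fun hcd => hce (hcd.trans hde)]

theorem verschiebung_add {e : ℕ} (he : e ∣ m) (x y : BigWitt e R) :
    verschiebung e m (x + y) = verschiebung e m x + verschiebung e m y := by
  obtain ⟨x, rfl⟩ := map_cover_surjective x
  obtain ⟨y, rfl⟩ := map_cover_surjective y
  simp only [← map_add, ← map_verschiebung]
  congr 1
  refine ext_ghost_div fun c hc => ?_
  have he0 : e ≠ 0 := ne_zero_of_dvd_ne_zero (Nat.mem_divisors.mp hc).2 he
  simp only [ghost_add _ _ (QWitt.div_mem_divisors hc), QWitt.ghost_verschiebung_div hc he]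
  split_ifs with hce
  · rw [ghost_add _ _ (QWitt.div_mem_divisors (Nat.mem_divisors.mpr ⟨hce, he0⟩)), mul_add]
  · rw [add_zero]

/-- The Verschiebung as an additive homomorphism. -/
noncomputable def verschiebungHom (R : Type*) [CommRing R] {e m : ℕ} (he : e ∣ m) :
    BigWitt e R →+ BigWitt m R :=
  AddMonoidHom.mk' (verschiebung e m) (verschiebung_add he)

theorem verschiebung_mul_frobenius {e : ℕ} (he : e ∣ m) (x : BigWitt e R) (y : BigWitt m R) :
    verschiebung e m (x * frobenius e m y) = verschiebung e m x * y := by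
  obtain ⟨x, rfl⟩ := map_cover_surjective x
  obtain ⟨y, rfl⟩ := map_cover_surjective y
  simp only [← map_mul, ← map_frobenius, ← map_verschiebung]
  congr 1
  refine ext_ghost_div fun c hc => ?_
  have hm0 := (Nat.mem_divisors.mp hc).2
  have he0 : e ≠ 0 := ne_zero_of_dvd_ne_zero hm0 he
  rw [ghost_mul _ _ (QWitt.div_mem_divisors hc), QWitt.ghost_verschiebung_div hc he,
    QWitt.ghost_verschiebung_div hc he]
  split_ifs with hce
  · have hec := QWitt.div_mem_divisors (Nat.mem_divisors.mpr ⟨hce, he0⟩)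
    rw [ghost_mul _ _ hec, ghost_frobenius he hm0 _ hec, Nat.div_mul_div he hce, mul_assoc]
  · rw [zero_mul]

theorem eq_sum_verschiebung_teichmuller (x : BigWitt m R) :
    x = ∑ d ∈ m.divisors, verschiebung (m / d) m (teichmuller (m / d) (x.coeff d)) := by
  obtain ⟨x, rfl⟩ := map_cover_surjective x
  simp only [coeff_map, ← map_teichmuller, ← map_verschiebung, ← map_sum]
  congr 1
  refine ext_ghost fun e he => ?_
  have hm := (Nat.mem_divisors.mp he).2
  have hem := Nat.dvd_of_mem_divisors he
  rw [ghost_sum _ _ he, ghost, ghostSum,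
    ← Nat.divisors_filter_dvd_of_dvd hm hem, Finset.sum_filter]
  refine Finset.sum_congr rfl fun d hd => ?_
  have hdm := Nat.dvd_of_mem_divisors hd
  rw [ghost_verschiebung (Nat.div_dvd_of_dvd hdm) _ he, Nat.div_div_self hdm hm]
  split_ifs with hde
  · rw [ghost_teichmuller]
    exact Nat.mem_divisors.mpr
      ⟨Nat.div_dvd_div hde hem, ne_zero_of_mem (QWitt.div_mem_divisors hd)⟩
  · rfl

end BigWitt

section Cyclotomic

variable {A : Type*} [CommRing A]

theorem isCoprime_geom_sum_self (x : A) {a : ℕ} (ha : a ≠ 0) :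
    IsCoprime (∑ i ∈ Finset.range a, x ^ i) x := by
  obtain ⟨c, rfl⟩ := Nat.exists_eq_succ_of_ne_zero ha
  refine ⟨1, -∑ i ∈ Finset.range c, x ^ i, ?_⟩
  rw [geom_sum_succ]
  ring

theorem isCoprime_geom_sum_mul_add {x : A} {a r : ℕ} (ha : a ≠ 0)
    (h : IsCoprime (∑ i ∈ Finset.range a, x ^ i) (∑ i ∈ Finset.range r, x ^ i)) (k : ℕ) :
    IsCoprime (∑ i ∈ Finset.range a, x ^ i) (∑ i ∈ Finset.range (a * k + r), x ^ i) := by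
  induction k with
  | zero => simpa using h
  | succ k ih =>
    rw [mul_add_one, add_comm (a * k) a, add_assoc, Finset.sum_range_add, add_comm]
    simp only [pow_add x a, ← Finset.mul_sum]
    simpa using ((isCoprime_geom_sum_self x ha).pow_right.mul_right ih).add_mul_left_right 1

theorem isCoprime_geom_sum (x : A) {a b : ℕ} (h : Nat.Coprime a b) :
    IsCoprime (∑ i ∈ Finset.range a, x ^ i) (∑ i ∈ Finset.range b, x ^ i) := by
  induction a, b using Nat.gcd.induction with
  | H0 n =>
    rw [Nat.coprime_zero_left] at h
    simp [h, isCoprime_one_right]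
  | H1 a b ha ih =>
    have hmod : Nat.Coprime (b % a) a := by rwa [Nat.Coprime, ← Nat.gcd_rec]
    simpa only [Nat.div_add_mod] using
      isCoprime_geom_sum_mul_add ha.ne' (ih hmod).symm (b / a)

theorem prod_cyclotomic_filter_not_dvd (A : Type*) [CommRing A] {e d : ℕ} (he : e ≠ 0)
    (hd : d ∣ e) :
    ∏ f ∈ e.divisors with ¬ f ∣ d, cyclotomic f A = ∑ i ∈ Finset.range (e / d), (X ^ d) ^ i := by
  have hd0 : d ≠ 0 := ne_zero_of_dvd_ne_zero he hd
  refine (monic_X_pow_sub_C (1 : A) hd0).isRegular.right ?_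
  simp only [map_one]
  rw [geom_sum_mul, ← pow_mul, Nat.mul_div_cancel' hd,
    ← prod_cyclotomic_eq_X_pow_sub_one (Nat.pos_of_ne_zero he),
    ← prod_cyclotomic_eq_X_pow_sub_one (Nat.pos_of_ne_zero hd0),
    ← Nat.divisors_filter_dvd_of_dvd he hd, mul_comm, Finset.prod_filter_mul_prod_filter_not]

theorem cyclotomic_dvd_geom_sum (A : Type*) [CommRing A] {e d : ℕ} (he : e ≠ 0) (hd : d ∣ e)
    (hed : ¬ e ∣ d) :
    cyclotomic e A ∣ ∑ i ∈ Finset.range (e / d), (X ^ d) ^ i := by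
  rw [← prod_cyclotomic_filter_not_dvd A he hd]
  refine Finset.dvd_prod_of_mem _
    (Finset.mem_filter.mpr ⟨Nat.mem_divisors_self e he, hed⟩)

theorem isCoprime_cyclotomic (A : Type*) [CommRing A] {f g : ℕ} (hfg : ¬ f ∣ g) (hgf : ¬ g ∣ f) :
    IsCoprime (cyclotomic f A) (cyclotomic g A) := by
  have hf : f ≠ 0 := fun h => hgf (h ▸ dvd_zero g)
  have hg : g ≠ 0 := fun h => hfg (h ▸ dvd_zero f)
  have hgcd : Nat.Coprime (f / f.gcd g) (g / f.gcd g) :=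
    Nat.coprime_div_gcd_div_gcd (Nat.gcd_pos_of_pos_left _ (Nat.pos_of_ne_zero hf))
  refine ((isCoprime_geom_sum (X ^ f.gcd g) hgcd).of_isCoprime_of_dvd_left ?_)
    |>.of_isCoprime_of_dvd_right ?_
  · exact cyclotomic_dvd_geom_sum A hf (Nat.gcd_dvd_left f g)
      fun h => hfg (h.trans (Nat.gcd_dvd_right f g))
  · exact cyclotomic_dvd_geom_sum A hg (Nat.gcd_dvd_right f g)
      fun h => hgf (h.trans (Nat.gcd_dvd_left f g))

theorem prod_inter_mem_of_isCoprime {ι : Type*} [DecidableEq ι] {I : Ideal A} {s t : Finset ι}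
    {f : ι → A} (hco : ∀ i ∈ s \ t, ∀ j ∈ t \ s, IsCoprime (f i) (f j)) (hs : ∏ i ∈ s, f i ∈ I)
    (ht : ∏ i ∈ t, f i ∈ I) : ∏ i ∈ s ∩ t, f i ∈ I := by
  obtain ⟨u, v, huv⟩ : IsCoprime (∏ i ∈ s \ t, f i) (∏ j ∈ t \ s, f j) :=
    IsCoprime.prod_left fun i hi => IsCoprime.prod_right fun j hj => hco i hi j hj
  rw [← Finset.prod_inter_mul_prod_sdiff s t] at hs
  rw [← Finset.prod_inter_mul_prod_sdiff t s, Finset.inter_comm] at ht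
  have h := I.add_mem (I.mul_mem_left u hs) (I.mul_mem_left v ht)
  rwa [mul_left_comm u, mul_left_comm v, ← mul_add, huv, mul_one] at h

theorem divisors_filter_forall_not_dvd_div {e : ℕ} (he : e ≠ 0) :
    {f ∈ e.divisors | ∀ p ∈ e.primeFactors, ¬ f ∣ e / p} = {e} := by
  ext f
  simp only [Finset.mem_filter, Nat.mem_divisors, Finset.mem_singleton, Nat.mem_primeFactors]
  constructor
  · rintro ⟨⟨⟨k, rfl⟩, -⟩, hf⟩
    by_contra hne
    have hk : k ≠ 1 := by rintro rfl; simp at hne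
    obtain ⟨p, hp, hpk⟩ := Nat.exists_prime_and_dvd hk
    refine hf p ⟨hp, hpk.mul_left f, he⟩ ?_
    rw [Nat.mul_div_assoc f hpk]
    exact dvd_mul_right f _
  · rintro rfl
    refine ⟨⟨dvd_rfl, he⟩, fun p hp hdvd => ?_⟩
    have hpos : 0 < f / p := Nat.div_pos (Nat.le_of_dvd (Nat.pos_of_ne_zero he) hp.2.1) hp.1.pos
    exact (Nat.le_of_dvd hpos hdvd).not_gt
      (Nat.div_lt_self (Nat.pos_of_ne_zero he) hp.1.one_lt)

theorem cyclotomic_mem_of_geom_sum_mem {e : ℕ} (he : e ≠ 0) {I : Ideal A[X]}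
    (h0 : X ^ e - 1 ∈ I)
    (h : ∀ d, d ∣ e → d < e → ∑ i ∈ Finset.range (e / d), (X ^ d) ^ i ∈ I) :
    cyclotomic e A ∈ I := by
  suffices key : ∀ T ⊆ e.primeFactors,
      ∏ f ∈ e.divisors with ∀ p ∈ T, ¬ f ∣ e / p, cyclotomic f A ∈ I by
    simpa only [divisors_filter_forall_not_dvd_div he, Finset.prod_singleton] using
      key _ subset_rfl
  intro T
  induction T using Finset.induction_on with
  | empty =>
    intro _
    simpa [prod_cyclotomic_eq_X_pow_sub_one (Nat.pos_of_ne_zero he)] using h0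
  | insert l T _ ih =>
    intro hT
    obtain ⟨hle, hTe⟩ := Finset.insert_subset_iff.mp hT
    have hl_prime : l.Prime := Nat.prime_of_mem_primeFactors hle
    have hdiv : e / l ∣ e := Nat.div_dvd_of_dvd (Nat.dvd_of_mem_primeFactors hle)
    have hgeom := h (e / l) hdiv (Nat.div_lt_self (Nat.pos_of_ne_zero he) hl_prime.one_lt)
    rw [← prod_cyclotomic_filter_not_dvd A he hdiv] at hgeom
    simp only [Finset.forall_mem_insert, Finset.filter_and]
    refine prod_inter_mem_of_isCoprime (fun f hf g hg => ?_) hgeom (ih hTe)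
    simp only [Finset.mem_sdiff, Finset.mem_filter, not_and, not_forall, not_not] at hf hg
    obtain ⟨p, hp, hfp⟩ := hf.2 hf.1.1
    exact isCoprime_cyclotomic A (fun hfg => hf.1.2 (hfg.trans (hg.2 hg.1.1)))
      (fun hgf => hg.1.2 p hp (hgf.trans hfp))

end Cyclotomic

theorem eq_zero_of_sum_of_mul_root_pow_eq_zero {A : Type*} [CommRing A] {f : A[X]} (hf : f.Monic)
    {n : ℕ} (hn : n ≤ f.natDegree) {a : Fin n → A}
    (h : ∑ i, AdjoinRoot.of f (a i) * AdjoinRoot.root f ^ (i : ℕ) = 0) (i : Fin n) : a i = 0 := by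
  nontriviality A
  have hmk : AdjoinRoot.mk f (∑ i, C (a i) * X ^ (i : ℕ)) = 0 := by simpa using h
  have hdeg : (∑ i, C (a i) * X ^ (i : ℕ)).degree < f.degree :=
    (degree_sum_fin_lt a).trans_le
      ((Nat.cast_le.mpr hn).trans (degree_eq_natDegree hf.ne_zero).ge)
  have hzero : ∑ i, C (a i) * X ^ (i : ℕ) = 0 := by
    by_contra hne
    exact AdjoinRoot.mk_ne_zero_of_degree_lt hf hne hdeg hmk
  have hcoeff := congrArg (coeff · (i : ℕ)) hzero
  simpa [finsetSum_coeff, coeff_C_mul, coeff_X_pow, Fin.val_inj] using hcoeff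

namespace QWitt

variable {m : ℕ} {R S : Type*} [CommRing R] [CommRing S]

section Generators

/-- The element `q` of `q-W_m(R)`. -/
noncomputable def q (m : ℕ) (R : Type*) [CommRing R] : QWitt m R := Ideal.Quotient.mk _ X

/-- The structure map `W_m(R) → q-W_m(R)`. -/
noncomputable def ofWitt (m : ℕ) (R : Type*) [CommRing R] : BigWitt m R →+* QWitt m R :=
  (Ideal.Quotient.mk _).comp C

theorem ghostCoord_q {e : ℕ} (he : e ∈ m.divisors) :
    ghostCoord R he (q m R) = AdjoinRoot.root (cyclotomic e R) :=
  preGhost_X he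

theorem ghostCoord_ofWitt {e : ℕ} (he : e ∈ m.divisors) (x : BigWitt m R) :
    ghostCoord R he (ofWitt m R x) = AdjoinRoot.of (cyclotomic e R) (x.ghost (m / e)) :=
  preGhost_C he x

theorem ghostCoord_ofWitt_verschiebung {d e : ℕ} (hd : d ∈ m.divisors) (he : e ∣ m)
    (x : BigWitt e R) : ghostCoord R hd (ofWitt m R (BigWitt.verschiebung e m x)) =
      if d ∣ e then AdjoinRoot.of (cyclotomic d R) (((m / e : ℕ) : R) * x.ghost (e / d))
      else 0 := by
  rw [ghostCoord_ofWitt, ghost_verschiebung_div hd he]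
  split_ifs
  · rfl
  · exact map_zero _

theorem q_pow_sub_one_mul_ofWitt_verschiebung {e : ℕ} (he : e ∣ m) (x : BigWitt e R) :
    (q m R ^ e - 1) * ofWitt m R (BigWitt.verschiebung e m x) = 0 :=
  Ideal.Quotient.eq_zero_iff_mem.mpr (Ideal.subset_span (Or.inl ⟨e, he, x, rfl⟩))

theorem geom_sum_q_mul_ofWitt_verschiebung {d e : ℕ} (hde : d ∣ e) (he : e ∣ m)
    (x : BigWitt e R) :
    (∑ i ∈ Finset.range (e / d), (q m R ^ d) ^ i) * ofWitt m R (BigWitt.verschiebung e m x) =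
      ofWitt m R (BigWitt.verschiebung d m (BigWitt.frobenius d e x)) := by
  have h : _ ∈ qWittIdeal m R := Ideal.subset_span (Or.inr ⟨d, e, hde, he, x, rfl⟩)
  have hmk := Ideal.Quotient.mk_eq_mk_iff_sub_mem _ _ |>.mpr h
  rw [map_mul, map_sum] at hmk
  exact hmk

end Generators

section Injectivity

/-- The ideal of `q-W_m(R)` generated by the images of the `V_{m/d}` with `d < n`. These ideals
filter `q-W_m(R)`; the `e`-th `q`-ghost coordinate lives on the step from `n = e` to `e + 1`. -/
noncomputable def verschiebungIdeal (m : ℕ) (R : Type*) [CommRing R] (n : ℕ) :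
    Ideal (QWitt m R) :=
  Ideal.span
    {c | ∃ d, d ∣ m ∧ d < n ∧ ∃ x : BigWitt d R, c = ofWitt m R (BigWitt.verschiebung d m x)}

theorem ofWitt_verschiebung_mem {d n : ℕ} (hd : d ∣ m) (hdn : d < n) (x : BigWitt d R) :
    ofWitt m R (BigWitt.verschiebung d m x) ∈ verschiebungIdeal m R n :=
  Ideal.subset_span ⟨d, hd, hdn, x, rfl⟩

theorem verschiebungIdeal_one (hm : m ≠ 0) : verschiebungIdeal m R 1 = ⊥ := by
  refine Ideal.span_eq_bot.mpr ?_
  rintro _ ⟨d, hd, hd1, -⟩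
  exact absurd (Nat.lt_one_iff.mp hd1) (ne_zero_of_dvd_ne_zero hm hd)

theorem verschiebungIdeal_succ_self (hm : m ≠ 0) : verschiebungIdeal m R (m + 1) = ⊤ := by
  rw [Ideal.eq_top_iff_one, ← map_one (ofWitt m R), ← BigWitt.verschiebung_self hm 1]
  exact ofWitt_verschiebung_mem dvd_rfl m.lt_succ_self 1

theorem verschiebungIdeal_succ_le {e : ℕ} (he : ¬ e ∣ m) :
    verschiebungIdeal m R (e + 1) ≤ verschiebungIdeal m R e := by
  refine Ideal.span_le.mpr ?_
  rintro _ ⟨d, hd, hde, x, rfl⟩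
  have hne : d ≠ e := by rintro rfl; exact he hd
  exact ofWitt_verschiebung_mem hd (lt_of_le_of_ne (Nat.lt_succ_iff.mp hde) hne) x

theorem ghostCoord_eq_zero_of_mem {e : ℕ} (he : e ∈ m.divisors) {c : QWitt m R}
    (hc : c ∈ verschiebungIdeal m R e) : ghostCoord R he c = 0 := by
  suffices h : verschiebungIdeal m R e ≤ RingHom.ker (ghostCoord R he) from h hc
  refine Ideal.span_le.mpr ?_
  rintro _ ⟨d, hd, hde, x, rfl⟩
  have hd0 : d ≠ 0 := ne_zero_of_dvd_ne_zero (Nat.mem_divisors.mp he).2 hd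
  have hed : ¬ e ∣ d := Nat.not_dvd_of_pos_of_lt (Nat.pos_of_ne_zero hd0) hde
  rw [SetLike.mem_coe, RingHom.mem_ker, ghostCoord_ofWitt_verschiebung he hd, if_neg hed]

theorem ofWitt_verschiebung_mem_of_ghost_one_eq_zero {e : ℕ} (he : e ∈ m.divisors)
    {x : BigWitt e R} (hx : x.ghost 1 = 0) :
    ofWitt m R (BigWitt.verschiebung e m x) ∈ verschiebungIdeal m R e := by
  have hem := Nat.dvd_of_mem_divisors he
  change ofWitt m R (BigWitt.verschiebungHom R hem x) ∈ _
  rw [BigWitt.eq_sum_verschiebung_teichmuller x, map_sum, map_sum]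
  refine Ideal.sum_mem _ fun f hf => ?_
  have hfe := Nat.dvd_of_mem_divisors hf
  change ofWitt m R (BigWitt.verschiebung e m _) ∈ _
  rw [BigWitt.verschiebung_verschiebung (Nat.div_dvd_of_dvd hfe) hem]
  obtain rfl | hf1 := eq_or_ne f 1
  · rw [← BigWitt.ghost_at_one, hx, BigWitt.teichmuller_zero]
    change ofWitt m R (BigWitt.verschiebungHom R ((Nat.div_dvd_of_dvd hfe).trans hem) 0) ∈ _
    rw [map_zero, map_zero]
    exact Ideal.zero_mem _
  · have hf0 := Nat.pos_of_mem_divisors hf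
    exact ofWitt_verschiebung_mem ((Nat.div_dvd_of_dvd hfe).trans hem)
      (Nat.div_lt_self (Nat.pos_of_mem_divisors he) (by omega)) _

theorem mk_cyclotomic_mul_ofWitt_verschiebung_mem {e : ℕ} (he : e ∈ m.divisors)
    (y : BigWitt e R) :
    Ideal.Quotient.mk (qWittIdeal m R) (cyclotomic e (BigWitt m R)) *
      ofWitt m R (BigWitt.verschiebung e m y) ∈ verschiebungIdeal m R e := by
  have hem := Nat.dvd_of_mem_divisors he
  let J := ((verschiebungIdeal m R e).colon {ofWitt m R (BigWitt.verschiebung e m y)}).comap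
    (Ideal.Quotient.mk (qWittIdeal m R))
  have mem_J (F : (BigWitt m R)[X]) : F ∈ J ↔ Ideal.Quotient.mk (qWittIdeal m R) F *
      ofWitt m R (BigWitt.verschiebung e m y) ∈ verschiebungIdeal m R e := by
    rw [Ideal.mem_comap, Submodule.mem_colon_singleton, smul_eq_mul]
  rw [← mem_J]
  refine cyclotomic_mem_of_geom_sum_mem (BigWitt.ne_zero_of_mem he) ?_ fun d hde hlt => ?_
  · rw [mem_J, map_sub, map_pow, map_one]
    refine Eq.symm (q_pow_sub_one_mul_ofWitt_verschiebung hem y) ▸ Ideal.zero_mem _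
  · simp only [mem_J, map_sum, map_pow]
    exact Eq.symm (geom_sum_q_mul_ofWitt_verschiebung hde hem y) ▸
      ofWitt_verschiebung_mem (hde.trans hem) hlt _

theorem ofWitt_verschiebung_mul_mk_monomial {e : ℕ} (he : e ∣ m) (y : BigWitt e R) (i : ℕ)
    (g : BigWitt m R) :
    ofWitt m R (BigWitt.verschiebung e m y) * Ideal.Quotient.mk _ (monomial i g) =
      ofWitt m R (BigWitt.verschiebung e m (y * BigWitt.frobenius e m g)) * q m R ^ i := by
  rw [BigWitt.verschiebung_mul_frobenius he, map_mul, mul_assoc, ← C_mul_X_pow_eq_monomial, map_mul,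
    map_pow]
  rfl

theorem exists_ofWitt_verschiebung_mul_sub_mem {e : ℕ} (he : e ∈ m.divisors) (y : BigWitt e R)
    (c : QWitt m R) : ∃ x : Fin e.totient → BigWitt e R,
      ofWitt m R (BigWitt.verschiebung e m y) * c -
        ∑ i, ofWitt m R (BigWitt.verschiebung e m (x i)) * q m R ^ (i : ℕ) ∈
          verschiebungIdeal m R e := by
  obtain ⟨F, rfl⟩ := Ideal.Quotient.mk_surjective c
  have hdeg : (cyclotomic e (BigWitt m R)).degree ≤ e.totient :=
    degree_le_natDegree.trans (Nat.cast_le.mpr natDegree_cyclotomic_le)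
  refine ⟨fun i => y * BigWitt.frobenius e m ((F %ₘ cyclotomic e (BigWitt m R)).coeff i), ?_⟩
  simp only [← ofWitt_verschiebung_mul_mk_monomial (Nat.dvd_of_mem_divisors he)]
  rw [← Finset.mul_sum, ← map_sum, sum_modByMonic_coeff (cyclotomic.monic e _) hdeg, ← mul_sub,
    ← map_sub, modByMonic_eq_sub_mul_div, sub_sub_cancel, map_mul, ← mul_assoc,
    mul_comm (ofWitt m R _)]
  exact Ideal.mul_mem_right _ _ (mk_cyclotomic_mul_ofWitt_verschiebung_mem he y)

theorem exists_sub_sum_mem {e : ℕ} (he : e ∈ m.divisors) {c : QWitt m R}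
    (hc : c ∈ verschiebungIdeal m R (e + 1)) : ∃ x : Fin e.totient → BigWitt e R,
      c - ∑ i, ofWitt m R (BigWitt.verschiebung e m (x i)) * q m R ^ (i : ℕ) ∈
        verschiebungIdeal m R e := by
  have hem := Nat.dvd_of_mem_divisors he
  have verschiebung_zero : BigWitt.verschiebung e m (0 : BigWitt e R) = 0 :=
    map_zero (BigWitt.verschiebungHom R hem)
  induction hc using Submodule.closure_induction with
  | zero => exact ⟨0, by simp [verschiebung_zero]⟩
  | add c d _ _ ihc ihd =>
    obtain ⟨x, hx⟩ := ihc
    obtain ⟨y, hy⟩ := ihd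
    refine ⟨x + y, ?_⟩
    simp only [Pi.add_apply, BigWitt.verschiebung_add hem, map_add, add_mul,
      Finset.sum_add_distrib, add_sub_add_comm]
    exact Ideal.add_mem _ hx hy
  | smul_mem r c hc =>
    obtain ⟨d, hd, hde, x, rfl⟩ := hc
    obtain rfl | hlt := eq_or_lt_of_le (Nat.lt_succ_iff.mp hde)
    · rw [smul_eq_mul, mul_comm]
      exact exists_ofWitt_verschiebung_mul_sub_mem he x r
    · refine ⟨0, ?_⟩
      simpa [verschiebung_zero] using Ideal.mul_mem_left _ r (ofWitt_verschiebung_mem hd hlt x)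

theorem mem_verschiebungIdeal_of_ghostCoord_eq_zero [IsAddTorsionFree R] {e : ℕ}
    (he : e ∈ m.divisors) {c : QWitt m R} (hc : c ∈ verschiebungIdeal m R (e + 1))
    (h : ghostCoord R he c = 0) : c ∈ verschiebungIdeal m R e := by
  have hem := Nat.dvd_of_mem_divisors he
  have hme : m / e ≠ 0 := BigWitt.ne_zero_of_mem (div_mem_divisors he)
  obtain ⟨x, hx⟩ := exists_sub_sum_mem he hc
  have hsum : ∑ i, AdjoinRoot.of (cyclotomic e R) (((m / e : ℕ) : R) * (x i).ghost 1) *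
      AdjoinRoot.root (cyclotomic e R) ^ (i : ℕ) = 0 := by
    have hsub := ghostCoord_eq_zero_of_mem he hx
    rw [map_sub, h, zero_sub, neg_eq_zero, map_sum] at hsub
    simpa only [map_mul, map_pow, ghostCoord_q, ghostCoord_ofWitt_verschiebung he hem, dvd_rfl,
      if_true, Nat.div_self (Nat.pos_of_mem_divisors he)] using hsub
  have hghost (i : Fin e.totient) : (x i).ghost 1 = 0 := by
    nontriviality R
    have hi := eq_zero_of_sum_of_mul_root_pow_eq_zero (cyclotomic.monic e R)
      (natDegree_cyclotomic e R).ge hsum i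
    rwa [← nsmul_eq_mul, nsmul_eq_zero_iff_right hme] at hi
  refine (Submodule.sub_mem_iff_left _ (Ideal.sum_mem _ fun i _ => ?_)).mp hx
  exact Ideal.mul_mem_right _ _ (ofWitt_verschiebung_mem_of_ghost_one_eq_zero he (hghost i))

theorem mem_verschiebungIdeal_of_ghost_eq_zero [IsAddTorsionFree R] {c : QWitt m R}
    (h : ghost m R c = 0) (hm : m ≠ 0) {n : ℕ} (hn : n ≤ m) :
    c ∈ verschiebungIdeal m R (n + 1) := by
  induction hn using Nat.decreasingInduction with
  | self => exact verschiebungIdeal_succ_self (R := R) hm ▸ Submodule.mem_top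
  | of_succ n _ ih =>
    by_cases hdvd : n + 1 ∣ m
    · exact mem_verschiebungIdeal_of_ghostCoord_eq_zero (Nat.mem_divisors.mpr ⟨hdvd, hm⟩) ih
        (congrFun h ⟨n + 1, Nat.mem_divisors.mpr ⟨hdvd, hm⟩⟩)
    · exact verschiebungIdeal_succ_le hdvd ih

theorem ghost_injective [IsAddTorsionFree R] (hm : m ≠ 0) :
    Function.Injective (ghost m R) := by
  refine (injective_iff_map_eq_zero _).mpr fun c hc => ?_
  have hmem := mem_verschiebungIdeal_of_ghost_eq_zero hc hm m.zero_le
  rwa [verschiebungIdeal_one hm, Ideal.mem_bot] at hmem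

end Injectivity

end QWitt

section NatArithmetic

variable {m n k p e : ℕ}

theorem lcm_mul_lcm_gcd (h : m ∣ n) (he : 0 < e) :
    e.lcm n * (e.gcd n).lcm m = n * e.lcm m := by
  have hgcd : (e.gcd n).gcd m = e.gcd m := by rw [Nat.gcd_assoc, Nat.gcd_eq_right h]
  refine Nat.eq_of_mul_eq_mul_left (Nat.gcd_pos_of_pos_left m he) ?_
  calc e.gcd m * (e.lcm n * (e.gcd n).lcm m)
      = e.lcm n * ((e.gcd n).gcd m * (e.gcd n).lcm m) := by rw [hgcd]; ring
    _ = e.gcd n * e.lcm n * m := by rw [Nat.gcd_mul_lcm]; ring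
    _ = e * m * n := by rw [Nat.gcd_mul_lcm]; ring
    _ = e.gcd m * (n * e.lcm m) := by rw [← Nat.gcd_mul_lcm e m]; ring

theorem div_lcm_gcd_mul_div_lcm (h : m ∣ n) (h' : n ∣ k) (he : e ∈ k.divisors) :
    n / (e.gcd n).lcm m * (k / e.lcm n) = k / e.lcm m := by
  have hek := Nat.dvd_of_mem_divisors he
  have hk0 : 0 < k := Nat.pos_of_ne_zero (Nat.mem_divisors.mp he).2
  have hlcm : e.lcm n ∣ k := Nat.lcm_dvd hek h'
  have hlcm' : (e.gcd n).lcm m ∣ n := Nat.lcm_dvd (Nat.gcd_dvd_right e n) h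
  rw [Nat.div_mul_div_comm hlcm' hlcm, mul_comm ((e.gcd n).lcm m),
    lcm_mul_lcm_gcd h (Nat.pos_of_mem_divisors he),
    Nat.mul_div_mul_left _ _ (Nat.pos_of_dvd_of_pos h' hk0)]

theorem prime_mul_gcd_eq_of_not_dvd (hp : p.Prime) (he : e ∣ p * m) (hem : ¬ e ∣ m) :
    p * e.gcd m = e := by
  have hdvd : e ∣ p * e.gcd m := Nat.gcd_mul_left p e m ▸ Nat.dvd_gcd (dvd_mul_left e p) he
  obtain ⟨l, hl⟩ := Nat.gcd_dvd_left e m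
  have hg : 0 < e.gcd m := Nat.pos_of_ne_zero fun h0 =>
    hem ((Nat.gcd_eq_zero_iff.mp h0).2 ▸ dvd_zero e)
  have hlp : l ∣ p := by
    rw [mul_comm p] at hdvd
    exact Nat.dvd_of_mul_dvd_mul_left hg (hl.symm.dvd.trans hdvd)
  have hl1 : l ≠ 1 := by
    rintro rfl
    rw [mul_one] at hl
    exact hem (Nat.gcd_eq_left_iff_dvd.mp hl.symm)
  rw [mul_comm, ← (hp.eq_one_or_self_of_dvd l hlp).resolve_left hl1, ← hl]

theorem prime_dvd_mul_div_iff (hp : p.Prime) (he : e ∣ p * m) : p ∣ p * m / e ↔ e ∣ m := by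
  rw [Nat.dvd_div_iff_mul_dvd he, mul_comm e, Nat.mul_dvd_mul_iff_left hp.pos]

theorem prime_mul_div_lcm_of_not_dvd (hp : p.Prime) (he : e ∈ (p * m).divisors) (hem : ¬ e ∣ m) :
    p * m / e.lcm m = 1 := by
  have hgcd := prime_mul_gcd_eq_of_not_dvd hp (Nat.dvd_of_mem_divisors he) hem
  have hpos : 0 < e.gcd m := Nat.gcd_pos_of_pos_left m (Nat.pos_of_mem_divisors he)
  have hlcm : e.lcm m = p * m := Nat.eq_of_mul_eq_mul_left hpos <|
    calc e.gcd m * e.lcm m = e * m := Nat.gcd_mul_lcm e m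
      _ = e.gcd m * (p * m) := by rw [← mul_assoc, mul_comm _ p, hgcd]
  rw [hlcm, Nat.div_self (Nat.pos_of_ne_zero (Nat.mem_divisors.mp he).2)]

end NatArithmetic

namespace QWitt

variable {m n k p e : ℕ} {R S : Type*} [CommRing R] [CommRing S]

theorem ringHom_ext {T : Type*} [CommRing T] {f g : QWitt m R →+* T}
    (hW : ∀ x, f (ofWitt m R x) = g (ofWitt m R x)) (hq : f (q m R) = g (q m R)) : f = g :=
  Ideal.Quotient.ringHom_ext (Polynomial.ringHom_ext hW hq)

theorem induction_on {P : QWitt m R → Prop} (c : QWitt m R)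
    (add : ∀ c d, P c → P d → P (c + d))
    (ofWitt_mul_q_pow : ∀ x i, P (ofWitt m R x * q m R ^ i)) : P c := by
  obtain ⟨F, rfl⟩ := Ideal.Quotient.mk_surjective c
  induction F using Polynomial.induction_on' with
  | add F G hF hG => exact map_add (Ideal.Quotient.mk (qWittIdeal m R)) F G ▸ add _ _ hF hG
  | monomial i x =>
    rw [← C_mul_X_pow_eq_monomial, map_mul, map_pow]
    exact ofWitt_mul_q_pow x i

section NormCoord

theorem subst_of {g e : ℕ} (hge : g ∣ e) (he : 0 < e) (r : R) :
    subst R hge he (AdjoinRoot.of _ r) = AdjoinRoot.of _ r :=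
  AdjoinRoot.lift_of _

theorem subst_root {g e : ℕ} (hge : g ∣ e) (he : 0 < e) :
    subst R hge he (AdjoinRoot.root _) = AdjoinRoot.root _ ^ (e / g) :=
  AdjoinRoot.lift_root _

/-- The ring homomorphism `c ↦ c_{(e,m)}(q^{e/(e,m)})`, of which the `e`-th `q`-ghost coordinate of
the cyclotomic norm of `c` is a power. -/
noncomputable def normCoord (R : Type*) [CommRing R] {m n e : ℕ} (h : m ∣ n)
    (he : e ∈ n.divisors) : QWitt m R →+* AdjoinRoot (cyclotomic e R) :=
  (subst R (Nat.gcd_dvd_left e m) (Nat.pos_of_mem_divisors he)).comp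
    (ghostCoord R (gcd_mem_divisors h ⟨e, he⟩))

theorem normCoord_ofWitt (h : m ∣ n) (he : e ∈ n.divisors) (x : BigWitt m R) :
    normCoord R h he (ofWitt m R x) = AdjoinRoot.of _ (x.ghost (m / e.gcd m)) := by
  rw [normCoord, RingHom.comp_apply, ghostCoord_ofWitt, subst_of]

theorem normCoord_q (h : m ∣ n) (he : e ∈ n.divisors) :
    normCoord R h he (q m R) = AdjoinRoot.root _ ^ (e / e.gcd m) := by
  rw [normCoord, RingHom.comp_apply, ghostCoord_q, subst_root]

theorem normCoord_self (h : m ∣ m) (he : e ∈ m.divisors) : normCoord R h he = ghostCoord R he := by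
  have hgcd : e.gcd m = e := Nat.gcd_eq_left (Nat.dvd_of_mem_divisors he)
  refine ringHom_ext (fun x => ?_) ?_
  · rw [normCoord_ofWitt, ghostCoord_ofWitt, hgcd]
  · rw [normCoord_q, ghostCoord_q, hgcd, Nat.div_self (Nat.pos_of_mem_divisors he), pow_one]

theorem subst_comp_normCoord (h : m ∣ n) (h' : n ∣ k) (he : e ∈ k.divisors) :
    (subst R (Nat.gcd_dvd_left e n) (Nat.pos_of_mem_divisors he)).comp
      (normCoord R h (gcd_mem_divisors h' ⟨e, he⟩)) = normCoord R (h.trans h') he := by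
  have hgcd : (e.gcd n).gcd m = e.gcd m := by rw [Nat.gcd_assoc, Nat.gcd_eq_right h]
  have hdvd : e.gcd m ∣ e.gcd n := Nat.gcd_dvd_gcd_of_dvd_right e h
  refine ringHom_ext (fun x => ?_) ?_
  · rw [RingHom.comp_apply, normCoord_ofWitt, subst_of, normCoord_ofWitt, hgcd]
  · rw [RingHom.comp_apply, normCoord_q, map_pow, subst_root, normCoord_q, ← pow_mul, hgcd,
      Nat.div_mul_div (Nat.gcd_dvd_left e n) hdvd]

end NormCoord

/-- The `q`-Witt vector `z` has the `q`-ghost coordinates that the cyclotomic norm of `c` is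
required to have. -/
def IsNorm (h : m ∣ n) (c : QWitt m R) (z : QWitt n R) : Prop :=
  ghost n R z = ghostNorm R h (ghost m R c)

theorem isNorm_iff {h : m ∣ n} {c : QWitt m R} {z : QWitt n R} :
    IsNorm h c z ↔ ∀ (e : ℕ) (he : e ∈ n.divisors),
      ghostCoord R he z = normCoord R h he c ^ (n / e.lcm m) :=
  ⟨fun H e he => congrFun H ⟨e, he⟩, fun H => funext fun e => H e e.2⟩

theorem IsNorm.one (h : m ∣ n) : IsNorm h (1 : QWitt m R) 1 :=
  isNorm_iff.mpr fun e he => by rw [map_one, map_one, one_pow]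

theorem IsNorm.mul {h : m ∣ n} {c d : QWitt m R} {y z : QWitt n R} (hc : IsNorm h c y)
    (hd : IsNorm h d z) : IsNorm h (c * d) (y * z) := by
  rw [isNorm_iff] at *
  intro e he
  rw [map_mul, hc, hd, map_mul, mul_pow]

theorem IsNorm.pow {h : m ∣ n} {c : QWitt m R} {z : QWitt n R} (hc : IsNorm h c z) (i : ℕ) :
    IsNorm h (c ^ i) (z ^ i) := by
  induction i with
  | zero => simpa only [pow_zero] using IsNorm.one h
  | succ i ih => simpa only [pow_succ] using ih.mul hc

theorem IsNorm.refl (hm : m ≠ 0) (c : QWitt m R) : IsNorm dvd_rfl c c :=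
  isNorm_iff.mpr fun e he => by
    rw [normCoord_self, Nat.lcm_eq_right (Nat.dvd_of_mem_divisors he),
      Nat.div_self (Nat.pos_of_ne_zero hm), pow_one]

theorem IsNorm.trans {h : m ∣ n} {h' : n ∣ k} {c : QWitt m R} {y : QWitt n R} {z : QWitt k R}
    (hy : IsNorm h c y) (hz : IsNorm h' y z) : IsNorm (h.trans h') c z := by
  rw [isNorm_iff] at hy hz ⊢
  intro e he
  rw [hz, normCoord, RingHom.comp_apply, hy, map_pow, ← RingHom.comp_apply,
    subst_comp_normCoord h h', ← pow_mul]
  exact congrArg _ (div_lcm_gcd_mul_div_lcm h h' he)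

section PrimeNorm

theorem isNorm_prime_mul_iff (hp : p.Prime) {c : QWitt m R} {z : QWitt (p * m) R} :
    IsNorm (dvd_mul_left m p) c z ↔ ∀ (e : ℕ) (he : e ∈ (p * m).divisors), ghostCoord R he z =
      if e ∣ m then normCoord R (dvd_mul_left m p) he c ^ p
      else normCoord R (dvd_mul_left m p) he c := by
  refine isNorm_iff.trans (forall₂_congr fun e he => ?_)
  split_ifs with hem
  · have hm := right_ne_zero_of_mul (Nat.mem_divisors.mp he).2
    rw [Nat.lcm_eq_right hem, Nat.mul_div_cancel p (Nat.pos_of_ne_zero hm)]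
  · rw [prime_mul_div_lcm_of_not_dvd hp he hem, pow_one]

theorem isNorm_ofWitt_primeNorm (hp : p.Prime) (x : BigWitt m R) :
    IsNorm (dvd_mul_left m p) (ofWitt m R x) (ofWitt (p * m) R (BigWitt.primeNorm p x)) := by
  refine (isNorm_prime_mul_iff hp).mpr fun e he => ?_
  have hepm := Nat.dvd_of_mem_divisors he
  rw [ghostCoord_ofWitt, normCoord_ofWitt, BigWitt.ghost_primeNorm hp x (div_mem_divisors he),
    BigWitt.normSeq]
  simp only [prime_dvd_mul_div_iff hp hepm]
  split_ifs with hem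
  · rw [map_pow, Nat.gcd_eq_left hem, Nat.mul_div_assoc p hem, Nat.mul_div_cancel_left _ hp.pos]
  · have hdiv : p * m / e = m / e.gcd m := by
      rw [← Nat.mul_div_mul_left m _ hp.pos, prime_mul_gcd_eq_of_not_dvd hp hepm hem]
    rw [hdiv]

theorem isNorm_q_pow (hp : p.Prime) : IsNorm (dvd_mul_left m p) (q m R) (q (p * m) R ^ p) := by
  refine (isNorm_prime_mul_iff hp).mpr fun e he => ?_
  rw [map_pow, ghostCoord_q, normCoord_q]
  split_ifs with hem
  · rw [Nat.gcd_eq_left hem, Nat.div_self (Nat.pos_of_mem_divisors he), pow_one]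
  · have hpos : 0 < e.gcd m := Nat.gcd_pos_of_pos_left m (Nat.pos_of_mem_divisors he)
    have hgcd := prime_mul_gcd_eq_of_not_dvd hp (Nat.dvd_of_mem_divisors he) hem
    rw [Nat.div_eq_of_eq_mul_left hpos hgcd.symm]

theorem exists_ghostCoord_eq_mul_normCoord (h : m ∣ n) (c : QWitt m R) :
    ∃ z : QWitt n R, ∀ (e : ℕ) (he : e ∈ n.divisors), ghostCoord R he z =
      if e ∣ m then ((n / m : ℕ) : AdjoinRoot _) * normCoord R h he c else 0 := by
  induction c using induction_on with
  | add c d hc hd =>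
    obtain ⟨y, hy⟩ := hc
    obtain ⟨z, hz⟩ := hd
    refine ⟨y + z, fun e he => ?_⟩
    rw [map_add, hy, hz]
    split_ifs
    · rw [map_add, mul_add]
    · rw [add_zero]
  | ofWitt_mul_q_pow x i =>
    refine ⟨ofWitt n R (BigWitt.verschiebung m n x) * q n R ^ i, fun e he => ?_⟩
    simp only [map_mul, map_pow, ghostCoord_ofWitt_verschiebung he h, ghostCoord_q,
      normCoord_ofWitt, normCoord_q]
    split_ifs with hem
    · rw [Nat.gcd_eq_left hem, Nat.div_self (Nat.pos_of_mem_divisors he), pow_one, map_natCast,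
        mul_assoc]
    · rw [zero_mul]

/- The defect of additivity `(c + d) ^ p - c ^ p - d ^ p` is a multiple of `p`, hence in the image
of the transfer, so it can be realised in the coordinates `e ∣ m` without changing the others. -/
theorem exists_isNorm_add (hp : p.Prime) {c d : QWitt m R} {y z : QWitt (p * m) R}
    (hc : IsNorm (dvd_mul_left m p) c y) (hd : IsNorm (dvd_mul_left m p) d z) :
    ∃ w, IsNorm (dvd_mul_left m p) (c + d) w := by
  simp only [isNorm_prime_mul_iff hp] at hc hd ⊢
  obtain ⟨r, hr⟩ := exists_add_pow_prime_eq hp c d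
  obtain ⟨w, hw⟩ := exists_ghostCoord_eq_mul_normCoord (dvd_mul_left m p) (c * d * r)
  refine ⟨y + z + w, fun e he => ?_⟩
  have hm := right_ne_zero_of_mul (Nat.mem_divisors.mp he).2
  rw [map_add, map_add, hc, hd, hw, Nat.mul_div_cancel p (Nat.pos_of_ne_zero hm)]
  split_ifs with hem
  · rw [← map_pow _ (c + d), hr]
    simp only [map_add, map_mul, map_pow, map_natCast, mul_assoc]
  · rw [add_zero, map_add]

theorem exists_isNorm_prime_mul (hp : p.Prime) (c : QWitt m R) :
    ∃ z, IsNorm (dvd_mul_left m p) c z := by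
  induction c using induction_on with
  | add c d hc hd =>
    obtain ⟨y, hy⟩ := hc
    obtain ⟨z, hz⟩ := hd
    exact exists_isNorm_add hp hy hz
  | ofWitt_mul_q_pow x i => exact ⟨_, (isNorm_ofWitt_primeNorm hp x).mul ((isNorm_q_pow hp).pow i)⟩

end PrimeNorm

theorem exists_isNorm (hn : n ≠ 0) (h : m ∣ n) (c : QWitt m R) : ∃ z, IsNorm h c z := by
  obtain ⟨k, hk⟩ := exists_eq_mul_left_of_dvd h
  induction k using Nat.recOnMul generalizing m n with
  | zero => exact absurd (hk.trans (zero_mul m)) hn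
  | one =>
    obtain rfl : n = m := hk.trans (one_mul m)
    exact ⟨c, IsNorm.refl hn c⟩
  | prime p hp =>
    subst hk
    exact exists_isNorm_prime_mul hp c
  | mul a b ha hb =>
    obtain rfl : n = a * (b * m) := hk.trans (mul_assoc a b m)
    obtain ⟨y, hy⟩ := hb (right_ne_zero_of_mul hn) (dvd_mul_left m b) c rfl
    obtain ⟨z, hz⟩ := ha hn (dvd_mul_left _ a) y rfl
    exact ⟨z, hy.trans hz⟩

end QWitt

theorem exists_map_eq_and_map_eq_of_forall_coeff {A B C : Type*} [Semiring A] [Semiring B]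
    [Semiring C] {φ : A →+* B} {ψ : A →+* C} {F : B[X]} {G : C[X]}
    (h : ∀ i, ∃ a, φ a = F.coeff i ∧ ψ a = G.coeff i) : ∃ H : A[X], H.map φ = F ∧ H.map ψ = G := by
  classical
  choose a hF hG using h
  refine ⟨∑ i ∈ F.support ∪ G.support, monomial i (a i), ?_, ?_⟩ <;> ext i
  · simp +contextual [Polynomial.map_sum, coeff_monomial, hF]
  · simp +contextual [Polynomial.map_sum, coeff_monomial, hG]

section KernelPair

variable {m : ℕ} {R S T : Type*} [CommRing R] [CommRing S] [CommRing T]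

/-- The ring of pairs `(r, s)` with `f r = f s`. -/
abbrev kernelPair (f : R →+* S) : Subring (R × R) :=
  (f.comp (RingHom.fst R R)).eqLocus (f.comp (RingHom.snd R R))

/-- The first projection of the kernel pair. -/
abbrev kernelPair.fst (f : R →+* S) : kernelPair f →+* R :=
  (RingHom.fst R R).comp (kernelPair f).subtype

/-- The second projection of the kernel pair. -/
abbrev kernelPair.snd (f : R →+* S) : kernelPair f →+* R :=
  (RingHom.snd R R).comp (kernelPair f).subtype

theorem kernelPair.comp_fst (f : R →+* S) :
    f.comp (kernelPair.fst f) = f.comp (kernelPair.snd f) :=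
  RingHom.ext fun w => w.2

instance [IsAddTorsionFree R] (f : R →+* S) : IsAddTorsionFree (kernelPair f) :=
  Subtype.val_injective.isAddTorsionFree (kernelPair f).subtype.toAddMonoidHom

theorem BigWitt.map_map (g : S →+* T) (f : R →+* S) (x : BigWitt m R) :
    map m g (map m f x) = map m (g.comp f) x :=
  BigWitt.ext_coeff fun e _ => by simp only [coeff_map, RingHom.comp_apply]

theorem BigWitt.exists_kernelPair_map_eq {f : R →+* S} {x y : BigWitt m R}
    (h : map m f x = map m f y) : ∃ w : BigWitt m (kernelPair f),
      map m (kernelPair.fst f) w = x ∧ map m (kernelPair.snd f) w = y := by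
  have hcoeff (e : ℕ) : f (x.coeff e) = f (y.coeff e) := by
    rw [← coeff_map, ← coeff_map, h]
  refine ⟨ofFun m fun e => ⟨(x.coeff e, y.coeff e), hcoeff e⟩, ext_coeff fun e he => ?_,
    ext_coeff fun e he => ?_⟩ <;> simp [coeff_map, coeff_ofFun _ he]

end KernelPair

namespace QWitt

variable {m n e : ℕ} {R S T : Type*} [CommRing R] [CommRing S] [CommRing T]

section Naturality

theorem map_mk (f : R →+* S) (F : (BigWitt m R)[X]) :
    map m f (Ideal.Quotient.mk _ F) = Ideal.Quotient.mk _ (F.map (BigWitt.map m f)) :=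
  Ideal.quotientMap_mk

theorem map_ofWitt (f : R →+* S) (x : BigWitt m R) :
    map m f (ofWitt m R x) = ofWitt m S (BigWitt.map m f x) :=
  (map_mk f (C x)).trans (congrArg _ (Polynomial.map_C _))

theorem map_q (f : R →+* S) : map m f (q m R) = q m S :=
  (map_mk f X).trans (congrArg _ (Polynomial.map_X _))

theorem map_map (g : S →+* T) (f : R →+* S) (c : QWitt m R) :
    map m g (map m f c) = map m (g.comp f) c :=
  RingHom.congr_fun (ringHom_ext (f := (map m g).comp (map m f))
    (fun x => by simp only [RingHom.comp_apply, map_ofWitt, BigWitt.map_map])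
    (by simp only [RingHom.comp_apply, map_q])) c

/-- The map `R[q]/Φ_e(q) → S[q]/Φ_e(q)` induced by a ring homomorphism `R → S`. -/
noncomputable def cyclotomicMap (e : ℕ) (f : R →+* S) :
    AdjoinRoot (cyclotomic e R) →+* AdjoinRoot (cyclotomic e S) :=
  AdjoinRoot.map f _ _ (by rw [map_cyclotomic])

theorem cyclotomicMap_of (e : ℕ) (f : R →+* S) (r : R) :
    cyclotomicMap e f (AdjoinRoot.of _ r) = AdjoinRoot.of _ (f r) :=
  AdjoinRoot.map_of ..

theorem cyclotomicMap_root (e : ℕ) (f : R →+* S) :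
    cyclotomicMap e f (AdjoinRoot.root _) = AdjoinRoot.root _ :=
  AdjoinRoot.map_root ..

theorem ghostCoord_map (he : e ∈ m.divisors) (f : R →+* S) (c : QWitt m R) :
    ghostCoord S he (map m f c) = cyclotomicMap e f (ghostCoord R he c) :=
  RingHom.congr_fun (ringHom_ext (f := (ghostCoord S he).comp (map m f))
    (g := (cyclotomicMap e f).comp (ghostCoord R he))
    (fun x => by simp only [RingHom.comp_apply, map_ofWitt, ghostCoord_ofWitt, cyclotomicMap_of,
      BigWitt.ghost_map])
    (by simp only [RingHom.comp_apply, map_q, ghostCoord_q, cyclotomicMap_root])) c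

theorem normCoord_map (h : m ∣ n) (he : e ∈ n.divisors) (f : R →+* S) (c : QWitt m R) :
    normCoord S h he (map m f c) = cyclotomicMap e f (normCoord R h he c) :=
  RingHom.congr_fun (ringHom_ext (f := (normCoord S h he).comp (map m f))
    (g := (cyclotomicMap e f).comp (normCoord R h he))
    (fun x => by simp only [RingHom.comp_apply, map_ofWitt, normCoord_ofWitt, cyclotomicMap_of,
      BigWitt.ghost_map])
    (by simp only [RingHom.comp_apply, map_q, normCoord_q, cyclotomicMap_root, map_pow])) c

theorem IsNorm.map {h : m ∣ n} {c : QWitt m R} {z : QWitt n R} (hz : IsNorm h c z) (f : R →+* S) :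
    IsNorm h (QWitt.map m f c) (QWitt.map n f z) := by
  rw [isNorm_iff] at hz ⊢
  intro e he
  rw [ghostCoord_map, normCoord_map, hz, map_pow]

theorem IsNorm.unique [IsAddTorsionFree R] (hn : n ≠ 0) {h : m ∣ n} {c : QWitt m R}
    {y z : QWitt n R} (hy : IsNorm h c y) (hz : IsNorm h c z) : y = z :=
  ghost_injective hn (Eq.trans hy (Eq.symm hz))

end Naturality

section Descent

variable {f : R →+* S}

theorem map_surjective (hf : Function.Surjective f) : Function.Surjective (map m f) := by
  intro c
  obtain ⟨F, rfl⟩ := Ideal.Quotient.mk_surjective c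
  obtain ⟨G, rfl⟩ := Polynomial.map_surjective _ (BigWitt.map_surjective hf) F
  exact ⟨Ideal.Quotient.mk _ G, map_mk f G⟩

theorem qWittIdeal_le_map (hf : Function.Surjective f) :
    qWittIdeal m S ≤ (qWittIdeal m R).map (mapRingHom (BigWitt.map m f)) := by
  conv_lhs => rw [qWittIdeal]
  rw [Ideal.span_le]
  rintro _ (⟨e, he, x, rfl⟩ | ⟨d, e, hde, he, x, rfl⟩) <;>
    obtain ⟨x, rfl⟩ := BigWitt.map_surjective hf x
  · have hmem := Ideal.mem_map_of_mem (I := qWittIdeal m R) (mapRingHom (BigWitt.map m f))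
      (Ideal.subset_span (Or.inl ⟨e, he, x, rfl⟩))
    simpa [BigWitt.map_verschiebung] using hmem
  · have hmem := Ideal.mem_map_of_mem (I := qWittIdeal m R) (mapRingHom (BigWitt.map m f))
      (Ideal.subset_span (Or.inr ⟨d, e, hde, he, x, rfl⟩))
    simpa [BigWitt.map_verschiebung, BigWitt.map_frobenius, Polynomial.map_sum] using hmem

theorem exists_mk_eq_and_map_eq_map (hf : Function.Surjective f) {c d : QWitt m R}
    (h : map m f c = map m f d) : ∃ F G : (BigWitt m R)[X],
      Ideal.Quotient.mk _ F = c ∧ Ideal.Quotient.mk _ G = d ∧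
        F.map (BigWitt.map m f) = G.map (BigWitt.map m f) := by
  obtain ⟨F, rfl⟩ := Ideal.Quotient.mk_surjective c
  obtain ⟨G, rfl⟩ := Ideal.Quotient.mk_surjective d
  rw [map_mk, map_mk, Ideal.Quotient.eq, ← Polynomial.map_sub] at h
  obtain ⟨H, hH, hFG⟩ := (Ideal.mem_map_iff_of_surjective _
    (Polynomial.map_surjective _ (BigWitt.map_surjective hf))).mp (qWittIdeal_le_map hf h)
  refine ⟨F - H, G, ?_, rfl, ?_⟩
  · rw [map_sub, Ideal.Quotient.eq_zero_iff_mem.mpr hH, sub_zero]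
  · rw [Polynomial.map_sub, ← coe_mapRingHom, hFG, coe_mapRingHom, Polynomial.map_sub,
      sub_sub_cancel]

theorem exists_kernelPair_map_eq (hf : Function.Surjective f) {c d : QWitt m R}
    (h : map m f c = map m f d) : ∃ w : QWitt m (kernelPair f),
      map m (kernelPair.fst f) w = c ∧ map m (kernelPair.snd f) w = d := by
  obtain ⟨F, G, rfl, rfl, hFG⟩ := exists_mk_eq_and_map_eq_map hf h
  obtain ⟨H, rfl, rfl⟩ := exists_map_eq_and_map_eq_of_forall_coeff fun i =>
    BigWitt.exists_kernelPair_map_eq (f := f) (x := F.coeff i) (y := G.coeff i)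
      (by rw [← Polynomial.coeff_map, hFG, Polynomial.coeff_map])
  exact ⟨Ideal.Quotient.mk _ H, map_mk _ H, map_mk _ H⟩

/- A common lift `w` of `c` and `d` to the kernel pair of `f` has a norm there; as `R` is
torsion-free, its two projections are the given norms of `c` and `d`. -/
theorem IsNorm.map_eq_map [IsAddTorsionFree R] (hn : n ≠ 0) (hf : Function.Surjective f)
    {h : m ∣ n} {c d : QWitt m R} {y z : QWitt n R} (hc : IsNorm h c y) (hd : IsNorm h d z)
    (hcd : QWitt.map m f c = QWitt.map m f d) : QWitt.map n f y = QWitt.map n f z := by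
  obtain ⟨w, rfl, rfl⟩ := exists_kernelPair_map_eq hf hcd
  obtain ⟨v, hv⟩ := exists_isNorm hn h w
  rw [hc.unique hn (hv.map _), hd.unique hn (hv.map _), map_map, map_map, kernelPair.comp_fst]

end Descent

section Norm

theorem map_cover_surjective : Function.Surjective (map m (BigWitt.cover R)) :=
  map_surjective BigWitt.cover_surjective

theorem exists_isNorm_map_cover_eq (hn : n ≠ 0) (h : m ∣ n) (c : QWitt m R) :
    ∃ b y, map m (BigWitt.cover R) b = c ∧ IsNorm h b y := by
  obtain ⟨b, rfl⟩ := map_cover_surjective c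
  exact ⟨b, (exists_isNorm hn h b).imp fun y hy => ⟨rfl, hy⟩⟩

theorem exists_norm (R : Type*) [CommRing R] (hn : n ≠ 0) (h : m ∣ n) :
    ∃ N : QWitt m R →* QWitt n R, ∀ b y, IsNorm h b y →
      N (map m (BigWitt.cover R) b) = map n (BigWitt.cover R) y := by
  choose lift liftNorm map_lift hlift using exists_isNorm_map_cover_eq (R := R) hn h
  let N (c : QWitt m R) : QWitt n R := map n (BigWitt.cover R) (liftNorm c)
  have hN (b y) (hb : IsNorm h b y) :
      N (map m (BigWitt.cover R) b) = map n (BigWitt.cover R) y :=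
    (hlift _).map_eq_map hn BigWitt.cover_surjective hb (map_lift _)
  refine ⟨{ toFun := N, map_one' := ?_, map_mul' := fun c d => ?_ }, hN⟩
  · simpa only [map_one] using hN 1 1 (IsNorm.one h)
  · simpa only [map_mul, map_lift] using hN _ _ ((hlift c).mul (hlift d))

/-- The cyclotomic norm `Π_{n/m}`. Its value at the image of a `q`-Witt vector `b` over the
polynomial ring `ℤ[R]` is the image of the unique `q`-Witt vector with the `q`-ghost coordinates
required of the norm of `b`. -/
noncomputable def norm (R : Type*) [CommRing R] (hn : n ≠ 0) (h : m ∣ n) :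
    QWitt m R →* QWitt n R :=
  (exists_norm R hn h).choose

theorem norm_map_cover (hn : n ≠ 0) {h : m ∣ n} {b : QWitt m (MvPolynomial R ℤ)}
    {y : QWitt n (MvPolynomial R ℤ)} (hb : IsNorm h b y) :
    norm R hn h (map m (BigWitt.cover R) b) = map n (BigWitt.cover R) y :=
  (exists_norm R hn h).choose_spec b y hb

theorem isNorm_norm (hn : n ≠ 0) (h : m ∣ n) (c : QWitt m R) : IsNorm h c (norm R hn h c) := by
  obtain ⟨b, y, rfl, hy⟩ := exists_isNorm_map_cover_eq hn h c
  exact norm_map_cover hn hy ▸ hy.map _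

theorem comp_cover (f : R →+* S) :
    f.comp (BigWitt.cover R) =
      (BigWitt.cover S).comp (MvPolynomial.rename f : MvPolynomial R ℤ →ₐ[ℤ] _).toRingHom :=
  MvPolynomial.ringHom_ext (fun _ => by simp) fun _ => by simp [BigWitt.cover]

theorem map_norm (hn : n ≠ 0) (h : m ∣ n) (f : R →+* S) (c : QWitt m R) :
    map n f (norm R hn h c) = norm S hn h (map m f c) := by
  obtain ⟨b, y, rfl, hy⟩ := exists_isNorm_map_cover_eq hn h c
  rw [norm_map_cover hn hy, map_map, map_map, comp_cover, ← map_map, ← map_map,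
    norm_map_cover hn (hy.map _)]

end Norm

end QWitt

theorem mainTheorem4 (m m' : ℕ) (hm' : 0 < m') (h : m ∣ m') :
    ∃ N : ∀ (R : Type u) [CommRing R], QWitt m R →* QWitt m' R,
      ((∀ (R S : Type u) [CommRing R] [CommRing S] (f : R →+* S) (c : QWitt m R),
          QWitt.map m' f (N R c) = N S (QWitt.map m f c)) ∧
        ∀ (R : Type u) [CommRing R] (c : QWitt m R),
          QWitt.ghost m' R (N R c) = QWitt.ghostNorm R h (QWitt.ghost m R c)) ∧
      ∀ N' : ∀ (R : Type u) [CommRing R], QWitt m R → QWitt m' R,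
        (∀ (R S : Type u) [CommRing R] [CommRing S] (f : R →+* S) (c : QWitt m R),
          QWitt.map m' f (N' R c) = N' S (QWitt.map m f c)) →
        (∀ (R : Type u) [CommRing R] (c : QWitt m R),
          QWitt.ghost m' R (N' R c) = QWitt.ghostNorm R h (QWitt.ghost m R c)) →
        ∀ (R : Type u) [CommRing R] (c : QWitt m R), N' R c = N R c := by
  refine ⟨fun R _ => QWitt.norm R hm'.ne' h, ⟨fun R S _ _ => QWitt.map_norm hm'.ne' h,
    fun R _ => QWitt.isNorm_norm hm'.ne' h⟩, fun N' map_N' isNorm_N' R _ c => ?_⟩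
  obtain ⟨b, rfl⟩ := QWitt.map_cover_surjective c
  rw [← map_N', QWitt.norm_map_cover hm'.ne' (isNorm_N' _ b)]
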